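/- **Notation.** For $d\in\mathbf Z$, $d\ge 1$, and real $x$ let $\circ_d(x)$ be $x$ rounded to $d$ significant binary digits (round to nearest, ties to even; $\circ_d(0)=0$). Floating-point operations on reals at working precision $d$ round the operands, operate exactly, and round the result: $x\oplus y=\circ_d(\circ_d(x)+\circ_d(y))$, and similarly $x\ominus y$, $x\otimes y$. For complex numbers, $(x+iy)\oplus(u+iv)=(x\oplus u)+i(y\oplus v)$ and $(x+iy)\otimes(u+iv)=\big((x\otimes u)\ominus(y\otimes v)\big)+i\big((x\otimes v)\oplus(y\otimes u)\big)$. A complex number is *representable* if its real and imaginary parts are of the form $m2^e$ with $m,e\in\mathbf Z$. For real $a\neq0$, $\mathrm{mag}(a)$ is the integer $b$ with $2^{b-1}\le|a|<2^b$; put $\mathrm{mag}(0)=1$. Let $$\mathcal R(s)=\int_{0\swarrow1}\frac{x^{-s}e^{\pi i x^2}}{e^{\pi i x}-e^{-\pi i x}}\,dx,$$ the integral being along the line of slope $1$ through $\tfrac12$, directed from the upper right to the lower left, with the principal value of $x^{-s}$. Let $$\vartheta(w)=\tfrac1{2i}\big(\log\Gamma(\tfrac14+\tfrac{iw}2)-\log\Gamma(\tfrac14-\tfrac{iw}2)\big)-\tfrac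 w2\log\pi$$ be the Riemann–Siegel theta function, where $\log\Gamma$ is the holomorphic branch on $\mathbf C\setminus(-\infty,0]$ that vanishes at $1$, and for $\sigma,t$ real put $\chi(\sigma+it)=e^{-2i\vartheta(t-i(\sigma-\frac12))}$. **Proposition.** Let $s=\sigma+it$ with $\sigma\in\mathbf R$, $t>0$, let $\varepsilon>0$, and let $M_1,M_2,X,T$ be real numbers with $$|\mathcal R(\sigma+it)|\le M_1,\quad |\mathcal R(1-\sigma+it)|\le M_2,\quad |\chi(\sigma+it)|\le X,\quad |\vartheta(t+i(\tfrac12-\sigma))|\le T.$$ Put $$\begin{aligned} \mathtt{wpbasic}&=\max\{6,\ 3+\mathrm{mag}(T),\ 2+\mathrm{mag}(2.12M_1+21.2M_2X+1.3M_2XT)-\mathrm{mag}(\varepsilon)+1\},\\ \mathtt{wptheta}&=\max\{4,\ 3+\mathrm{mag}(2.7M_2X)-\mathrm{mag}(\varepsilon)+1\},\\ \mathtt{wpR}&=3+\mathrm{mag}(1.1+2X)-\mathrm{mag}(\varepsilon)+1 . \end{aligned}$$ Let $\mathtt{theta},\mathtt{rzeta},\mathtt{rzeta2}\in\mathbf C$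 be computed values with $$|\mathtt{theta}-\vartheta(t-i(\sigma-\tfrac12))|\le2^{-\mathtt{wptheta}},\quad |\mathtt{rzeta}-\mathcal R(\sigma+it)|\le2^{-\mathtt{wpR}},\quad |\mathtt{rzeta2}-\overline{\mathcal R(1-\sigma+it)}|\le2^{-\mathtt{wpR}}.$$ At working precision $d=\mathtt{wpbasic}$ let $w=(-2i)\otimes\mathtt{theta}$, let $E$ be a computed value of $e^{w}$ with relative error at most $2^{-d}$, that is $|E-e^{w}|\le2^{-d}|e^{w}|$, and let $$\mathtt{zv}=\mathtt{rzeta}\oplus(E\otimes\mathtt{rzeta2}).$$ Then $\mathtt{zv}$ is a representable number and $|\mathtt{zv}-\zeta(\sigma+it)|<\varepsilon$. -/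

import Mathlib

namespace RiemannSiegel

noncomputable section

/-! ### Idealized multiple precision floating point arithmetic -/

/-- `mag a` is, for `a ≠ 0`, the integer `b` with `2 ^ (b - 1) ≤ |a| < 2 ^ b`. -/
def mag (a : ℝ) : ℤ := Int.log 2 |a| + 1

/-- The nearest integer, a tie going to the even neighbour. -/
def roundEven (x : ℝ) : ℤ :=
  if Int.fract x = 1 / 2 then 2 * ((⌊x⌋ + 1) / 2) else round x

/-- `∘_d(x)`: the real number `x` rounded to `d` significant binary digits, ties to even.
For `x ≠ 0` the last digit kept has weight `2 ^ (mag x - d)`; and `rnd d 0 = 0`. -/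
def rnd (d : ℤ) (x : ℝ) : ℝ :=
  (roundEven (x / (2 : ℝ) ^ (mag x - d)) : ℝ) * (2 : ℝ) ^ (mag x - d)

/-- Real floating point addition, subtraction and multiplication at working precision `d`:
the operands are rounded, the operation is done exactly, the result is rounded. -/
def fadd (d : ℤ) (x y : ℝ) : ℝ := rnd d (rnd d x + rnd d y)

def fsub (d : ℤ) (x y : ℝ) : ℝ := rnd d (rnd d x - rnd d y)

def fmul (d : ℤ) (x y : ℝ) : ℝ := rnd d (rnd d x * rnd d y)

/-- Complex floating point addition `a ⊕ b` at working precision `d`. -/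
def cadd (d : ℤ) (a b : ℂ) : ℂ := ⟨fadd d a.re b.re, fadd d a.im b.im⟩

/-- Complex floating point multiplication `a ⊗ b` at working precision `d`. -/
def cmul (d : ℤ) (a b : ℂ) : ℂ :=
  ⟨fsub d (fmul d a.re b.re) (fmul d a.im b.im),
    fadd d (fmul d a.re b.im) (fmul d a.im b.re)⟩

/-- Real representable numbers: `m * 2 ^ e` with integers `m`, `e`. -/
def IsDyadic (x : ℝ) : Prop := ∃ m e : ℤ, x = (m : ℝ) * (2 : ℝ) ^ e

/-- Complex representable numbers. -/
def IsRepresentable (a : ℂ) : Prop := IsDyadic a.re ∧ IsDyadic a.im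

/-! ### The functions `𝓡`, `ϑ` and `χ` -/

/-- The integrand `x ^ (-s) * exp (π i x²) / (exp (π i x) - exp (-π i x))` of `𝓡(s)`,
with the principal value of the power. -/
def rzetaIntegrand (s x : ℂ) : ℂ :=
  x ^ (-s) * Complex.exp (Real.pi * Complex.I * x ^ 2) /
    (Complex.exp (Real.pi * Complex.I * x) - Complex.exp (-(Real.pi * Complex.I * x)))

/-- Riemann's auxiliary function: the integral of `rzetaIntegrand s` along the straight line
through `1/2` of slope `1`, travelled from the upper right to the lower left. -/
def Rzeta (s : ℂ) : ℂ :=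
  ∫ u : ℝ, rzetaIntegrand s (1 / 2 - (u : ℂ) * Complex.exp (Real.pi * Complex.I / 4)) *
    (-Complex.exp (Real.pi * Complex.I / 4))

/-- The holomorphic branch of `log Γ` on the plane slit along `(-∞, 0]` that vanishes at `1`:
the integral of `Γ'/Γ` along the segment from `1` to `z`. -/
def logGamma (z : ℂ) : ℂ :=
  ∫ u in (0 : ℝ)..1, Complex.digamma (1 + (u : ℂ) * (z - 1)) * (z - 1)

/-- The Riemann-Siegel theta function of a complex variable, holomorphic off the two rays
`{i y : |y| ≥ 1/2}` and equal to `Im log Γ (1/4 + i t / 2) - (t / 2) log π` at real `t`. -/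
def siegelTheta (w : ℂ) : ℂ :=
  (logGamma (1 / 4 + Complex.I * w / 2) - logGamma (1 / 4 - Complex.I * w / 2)) /
      (2 * Complex.I)
    - w / 2 * (Real.log Real.pi : ℂ)

/-- `χ(s) = exp (-2 i ϑ(t - i (σ - 1/2)))` for `s = σ + i t`. -/
def chi (s : ℂ) : ℂ :=
  Complex.exp (-2 * Complex.I *
    siegelTheta ((s.im : ℂ) - Complex.I * ((s.re : ℂ) - 1 / 2)))

/-! ### The three working precisions -/

def wpbasic (M₁ M₂ X T ε : ℝ) : ℤ :=
  max 6 (max (3 + mag T)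
    (2 + mag (2.12 * M₁ + 21.2 * M₂ * X + 1.3 * M₂ * X * T) - mag ε + 1))

def wptheta (M₂ X ε : ℝ) : ℤ := max 4 (3 + mag (2.7 * M₂ * X) - mag ε + 1)

def wpR (X ε : ℝ) : ℤ := 3 + mag (1.1 + 2 * X) - mag ε + 1

end

end RiemannSiegel

/-! ### Rounding errors of the real and complex floating-point operations -/

namespace RiemannSiegel

/-! Two independent facts combine: the exact Riemann–Siegel formula ζ(s) = 𝓡(s) + χ(s)·conj 𝓡(1 −
conj s) for Im s > 0 (`riemannZeta_eq`), and an error budget for evaluating its right side in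
floating point.

The formula rests on Mordell's integral (`integral_mordell`), a closed form for the integral of
exp(−πix² + 2πixy)/(e^{πix} − e^{−πix}) along a line of direction ω³, where ω = e^{πi/4}. Replacing
x by x + 1 gives one linear relation between the integrals through −1/2 and 1/2. The second
relation, usually a residue at 0, comes from a removable singularity: the integrand at y minus the
integrand at 0 is holomorphic across 0, so the difference of the two integrals does not depend on y,
and the first relation at y = 0 evaluates it.

Put y = ωt, divide by 1 − e^{−2πiy}, multiply by t^{−s} and integrate over t > 0, with Re s < −1.
The three terms become a multiple of ζ(1 − s) (geometric series), a multiple of conj 𝓡(1 − conj s)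
(Fubini and Euler's integral), and an integral along a ray that is 𝓡(s) up to a factor, once the
line of 𝓡 has been moved to the origin (`Rzeta_eq_ray`). The functional equation of ζ turns this
into the formula for Re s < −1. Since 𝓡 is entire, the identity theorem extends it to the upper half
plane. That χ = exp(−2iϑ) is the factor of the functional equation is `chi_eq`.

For the numerical part write u = 2^{−d}, with η and δ the accuracies of `theta` and of the two
values of 𝓡. Each operation has a relative error of a small multiple of u (`norm_cadd_sub_le`,
`norm_cmul_sub_le`), and the multiplication by −2i only rounds `theta`. Propagating the errors
through the exponential (`norm_expv_sub_le`) and through the final product and sum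
(`norm_zv_sub_le`) gives a bound linear in u, η and δ. The three precisions make these parts less
than ε/2, ε/8 and ε/8. -/

lemma abs_roundEven_sub_le (x : ℝ) : |(roundEven x : ℝ) - x| ≤ 1 / 2 := by
  unfold roundEven
  split_ifs with h
  · have hx : x = ⌊x⌋ + 1 / 2 := by rw [← h]; exact (Int.floor_add_fract x).symm
    have hn : 2 * ((⌊x⌋ + 1) / 2) = ⌊x⌋ ∨ 2 * ((⌊x⌋ + 1) / 2) = ⌊x⌋ + 1 := by omega
    rcases hn with hn | hn <;> rw [hn] <;> rw [abs_le] <;> push_cast <;> constructor <;> linarith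
  · rw [abs_sub_comm]; exact abs_sub_round x

lemma roundEven_intCast (n : ℤ) : roundEven (n : ℝ) = n := by
  unfold roundEven
  rw [if_neg (by rw [Int.fract_intCast]; norm_num), round_intCast]

lemma rnd_zero (d : ℤ) : rnd d 0 = 0 := by
  have : roundEven (0 : ℝ) = 0 := by exact_mod_cast roundEven_intCast 0
  simp [rnd, this]

lemma zpow_mag_le (x : ℝ) (hx : x ≠ 0) : (2 : ℝ) ^ (mag x) ≤ 2 * |x| := by
  have h := Int.zpow_log_le_self (R := ℝ) (b := 2) (by norm_num) (abs_pos.2 hx)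
  rw [mag, zpow_add_one₀ (by norm_num)]
  push_cast at h
  linarith

lemma abs_lt_zpow_mag (x : ℝ) : |x| < (2 : ℝ) ^ (mag x) := by
  have h := Int.lt_zpow_succ_log_self (R := ℝ) (b := 2) (by norm_num) |x|
  exact_mod_cast h

/-- The relative error of a rounding to `d` digits is at most `2 ^ (-d)`. -/
lemma abs_rnd_sub_le (d : ℤ) (x : ℝ) : |rnd d x - x| ≤ (2 : ℝ) ^ (-d) * |x| := by
  rcases eq_or_ne x 0 with rfl | hx
  · simp [rnd_zero]
  have hp : (0 : ℝ) < 2 ^ (mag x - d) := by positivity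
  have h1 : rnd d x - x = ((roundEven (x / 2 ^ (mag x - d)) : ℝ) - x / 2 ^ (mag x - d)) *
      2 ^ (mag x - d) := by
    rw [rnd, sub_mul, div_mul_cancel₀ _ hp.ne']
  rw [h1, abs_mul, abs_of_pos hp]
  have h2 := abs_roundEven_sub_le (x / 2 ^ (mag x - d))
  have h3 := zpow_mag_le x hx
  have h4 : (2 : ℝ) ^ (mag x - d) = 2 ^ (-d) * 2 ^ mag x := by
    rw [← zpow_add₀ (by norm_num)]; congr 1; ring
  have h5 : (0 : ℝ) < 2 ^ (-d) := by positivity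
  calc _ ≤ 1 / 2 * (2 : ℝ) ^ (mag x - d) := by gcongr
    _ = 2 ^ (-d) * (2 ^ mag x / 2) := by rw [h4]; ring
    _ ≤ _ := by gcongr; linarith

/-- Numbers with at most `d` significant binary digits are not changed by rounding. -/
lemma rnd_eq_self {d m e : ℤ} (hd : 1 ≤ d) (hm : |(m : ℝ)| ≤ (2 : ℝ) ^ d) :
    rnd d (m * 2 ^ e) = m * 2 ^ e := by
  set y : ℝ := m * 2 ^ e with hy
  suffices h : ∃ k : ℤ, y / 2 ^ (mag y - d) = k by
    obtain ⟨k, hk⟩ := h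
    have hp : (0 : ℝ) < 2 ^ (mag y - d) := by positivity
    rw [rnd, hk, roundEven_intCast, ← hk, div_mul_cancel₀ _ hp.ne']
  rcases eq_or_ne y 0 with h0 | h0
  · exact ⟨0, by simp [h0]⟩
  have hle := zpow_mag_le y h0
  have habs : |y| = |(m : ℝ)| * 2 ^ e := by rw [hy, abs_mul, abs_of_pos (by positivity : (0:ℝ) < 2 ^ e)]
  have h1 : (2 : ℝ) ^ mag y ≤ 2 ^ (d + e + 1) := by
    rw [zpow_add_one₀ (by norm_num), zpow_add₀ (by norm_num)]
    have : |(m : ℝ)| * 2 ^ e ≤ 2 ^ d * 2 ^ e := by gcongr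
    linarith
  have h2 : mag y ≤ d + e + 1 := (zpow_le_zpow_iff_right₀ (by norm_num)).1 h1
  rcases h2.lt_or_eq with h3 | h3
  · obtain ⟨n, hn⟩ := Int.eq_ofNat_of_zero_le (show 0 ≤ e - (mag y - d) by omega)
    refine ⟨m * 2 ^ n, ?_⟩
    rw [hy, mul_div_assoc, ← zpow_sub₀ (by norm_num), ← hy, hn]
    push_cast; simp
  -- The extreme case: the last kept digit now has weight 2^(e+1), but |m| = 2^d is even because d ≥
  -- 1, so the quotient is still an integer.
  · have h4 : |(m : ℝ)| = 2 ^ d := by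
      refine le_antisymm hm ?_
      rw [h3, zpow_add_one₀ (by norm_num), zpow_add₀ (by norm_num), habs] at hle
      have h5 : (0 : ℝ) < 2 ^ e := by positivity
      exact le_of_mul_le_mul_right (by linarith) h5
    obtain ⟨n, hn⟩ := Int.eq_ofNat_of_zero_le (show 0 ≤ d - 1 by omega)
    have h6 : (2 : ℝ) ^ d * 2 ^ e / 2 ^ (mag y - d) = ((2 ^ n : ℤ) : ℝ) := by
      rw [← zpow_add₀ (by norm_num), ← zpow_sub₀ (by norm_num), h3,
        show d + e - (d + e + 1 - d) = (n : ℤ) by omega]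
      push_cast; simp
    rcases abs_choice (m : ℝ) with h | h
    · exact ⟨2 ^ n, by rw [← h6, ← h4, h]⟩
    · refine ⟨-2 ^ n, ?_⟩
      rw [Int.cast_neg, ← h6, ← h4, h, hy]; ring

/-- The scaled argument is less than 2^d in size, but rounding may carry it up to 2^d. This is why
the bound, like the hypothesis of `rnd_eq_self`, is not strict. -/
lemma exists_rnd_eq {d : ℤ} (hd : 0 ≤ d) (x : ℝ) :
    ∃ m e : ℤ, |(m : ℝ)| ≤ (2 : ℝ) ^ d ∧ rnd d x = m * 2 ^ e := by
  refine ⟨_, _, ?_, rfl⟩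
  set q := x / (2 : ℝ) ^ (mag x - d) with hq
  have h1 := abs_roundEven_sub_le q
  have h2 : |q| < 2 ^ d := by
    rw [hq, abs_div, abs_of_pos (by positivity : (0 : ℝ) < 2 ^ (mag x - d)),
      div_lt_iff₀ (by positivity), ← zpow_add₀ (by norm_num)]
    simpa using abs_lt_zpow_mag x
  have h3 : |(roundEven q : ℝ)| < 2 ^ d + 1 := by
    have := abs_sub_abs_le_abs_sub (roundEven q : ℝ) q
    linarith
  obtain ⟨n, rfl⟩ := Int.eq_ofNat_of_zero_le hd
  simp only [zpow_natCast] at h3 ⊢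
  have h4 : |roundEven q| < 2 ^ n + 1 := by exact_mod_cast h3
  exact_mod_cast Int.lt_add_one_iff.1 h4

lemma isDyadic_rnd (d : ℤ) (x : ℝ) : IsDyadic (rnd d x) := ⟨_, _, rfl⟩

/-- The zero real part of −2i kills two of the products, and doubling or negating a rounded number
is exact. The only error is the first rounding of `z`, much better than the general bound for a
complex product. -/
lemma cmul_neg_two_I {d : ℤ} (hd : 1 ≤ d) (z : ℂ) :
    cmul d (-2 * Complex.I) z = -2 * Complex.I * ⟨rnd d z.re, rnd d z.im⟩ := by
  have h2 : rnd d (-2) = -2 := by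
    have := rnd_eq_self (d := d) (m := -1) (e := 1) hd
      (by simpa using one_le_zpow₀ (by norm_num : (1 : ℝ) ≤ 2) (by omega))
    norm_num at this; exact this
  have key : ∀ x, rnd d (-2 * rnd d x) = -2 * rnd d x ∧ rnd d (2 * rnd d x) = 2 * rnd d x := by
    intro x
    obtain ⟨m, e, hm, h⟩ := exists_rnd_eq (by omega : 0 ≤ d) x
    have h3 : ∀ k : ℝ, k * 2 * (2 : ℝ) ^ e = k * 2 ^ (e + 1) := fun k => by
      rw [zpow_add_one₀ (by norm_num)]; ring
    constructor
    · have := rnd_eq_self (d := d) (m := -m) (e := e + 1) hd (by simpa using hm)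
      rw [h, show -2 * ((m : ℝ) * 2 ^ e) = ((-m : ℤ) : ℝ) * 2 ^ (e + 1) by
        rw [← h3]; push_cast; ring]
      exact this
    · have := rnd_eq_self (d := d) (m := m) (e := e + 1) hd hm
      rw [h, show 2 * ((m : ℝ) * 2 ^ e) = (m : ℝ) * 2 ^ (e + 1) by rw [← h3]; ring]
      exact this
  apply Complex.ext
  · simp [cmul, fsub, fmul, rnd_zero, h2, -neg_mul, (key z.im).1]
    rw [neg_mul, neg_neg, (key z.im).2]
  · simp [cmul, fadd, fmul, rnd_zero, h2, -neg_mul, (key z.re).1]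

/-- Rounding the operands costs u and rounding the sum costs u(1 + u); for u ≤ 1/64 the total 2u +
u² is below 2.02u. The error is relative to |x| + |y|, since cancellation may make the sum itself
small. -/
lemma abs_fadd_sub_le {d : ℤ} (hu : (2 : ℝ) ^ (-d) ≤ 1 / 64) (x y : ℝ) :
    |fadd d x y - (x + y)| ≤ 2.02 * (2 : ℝ) ^ (-d) * (|x| + |y|) := by
  set u := (2 : ℝ) ^ (-d)
  have hu0 : 0 < u := by positivity
  have h1 := abs_rnd_sub_le d x
  have h2 := abs_rnd_sub_le d y
  have h3 := abs_rnd_sub_le d (rnd d x + rnd d y)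
  have h4 : |rnd d x + rnd d y - (x + y)| ≤ u * (|x| + |y|) := by
    calc _ = |(rnd d x - x) + (rnd d y - y)| := by ring_nf
      _ ≤ _ := (abs_add_le _ _).trans (by linarith)
  have h5 : |rnd d x + rnd d y| ≤ (1 + u) * (|x| + |y|) := by
    calc _ = |(rnd d x + rnd d y - (x + y)) + (x + y)| := by ring_nf
      _ ≤ _ := (abs_add_le _ _).trans (by linarith [abs_add_le x y])
  have h6 : |fadd d x y - (x + y)| ≤ u * ((1 + u) * (|x| + |y|)) + u * (|x| + |y|) := by
    calc _ = |(fadd d x y - (rnd d x + rnd d y)) + (rnd d x + rnd d y - (x + y))| := by ring_nf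
      _ ≤ _ := (abs_add_le _ _).trans (add_le_add (h3.trans (by gcongr)) h4)
  refine h6.trans ?_
  have : 0 ≤ u * (|x| + |y|) := by positivity
  nlinarith

lemma abs_fsub_sub_le {d : ℤ} (hu : (2 : ℝ) ^ (-d) ≤ 1 / 64) (x y : ℝ) :
    |fsub d x y - (x - y)| ≤ 2.02 * (2 : ℝ) ^ (-d) * (|x| + |y|) := by
  set u := (2 : ℝ) ^ (-d)
  have hu0 : 0 < u := by positivity
  have h1 := abs_rnd_sub_le d x
  have h2 := abs_rnd_sub_le d y
  have h3 := abs_rnd_sub_le d (rnd d x - rnd d y)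
  have h4 : |rnd d x - rnd d y - (x - y)| ≤ u * (|x| + |y|) := by
    calc _ = |(rnd d x - x) - (rnd d y - y)| := by ring_nf
      _ ≤ _ := (abs_sub _ _).trans (by linarith)
  have h5 : |rnd d x - rnd d y| ≤ (1 + u) * (|x| + |y|) := by
    calc _ = |(rnd d x - rnd d y - (x - y)) + (x - y)| := by ring_nf
      _ ≤ _ := (abs_add_le _ _).trans (by linarith [abs_sub x y])
  have h6 : |fsub d x y - (x - y)| ≤ u * ((1 + u) * (|x| + |y|)) + u * (|x| + |y|) := by
    calc _ = |(fsub d x y - (rnd d x - rnd d y)) + (rnd d x - rnd d y - (x - y))| := by ring_nf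
      _ ≤ _ := (abs_add_le _ _).trans (add_le_add (h3.trans (by gcongr)) h4)
  refine h6.trans ?_
  have : 0 ≤ u * (|x| + |y|) := by positivity
  nlinarith

/-- Three roundings give the relative error (1 + u)³ − 1 = 3u + 3u² + u³, below 3.06u for u ≤ 1/64.
-/
lemma abs_fmul_sub_le {d : ℤ} (hu : (2 : ℝ) ^ (-d) ≤ 1 / 64) (x y : ℝ) :
    |fmul d x y - x * y| ≤ 3.06 * (2 : ℝ) ^ (-d) * (|x| * |y|) := by
  set u := (2 : ℝ) ^ (-d)
  have hu0 : 0 < u := by positivity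
  have h1 := abs_rnd_sub_le d x
  have h2 := abs_rnd_sub_le d y
  have h3 := abs_rnd_sub_le d (rnd d x * rnd d y)
  have h4 : |rnd d x| ≤ (1 + u) * |x| := by
    calc _ = |(rnd d x - x) + x| := by ring_nf
      _ ≤ _ := (abs_add_le _ _).trans (by linarith)
  have h5 : |rnd d y| ≤ (1 + u) * |y| := by
    calc _ = |(rnd d y - y) + y| := by ring_nf
      _ ≤ _ := (abs_add_le _ _).trans (by linarith)
  have h6 : |rnd d x * rnd d y - x * y| ≤ u * |x| * ((1 + u) * |y|) + |x| * (u * |y|) := by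
    calc _ = |(rnd d x - x) * rnd d y + x * (rnd d y - y)| := by ring_nf
      _ ≤ |rnd d x - x| * |rnd d y| + |x| * |rnd d y - y| := by
        rw [← abs_mul, ← abs_mul]; exact abs_add_le _ _
      _ ≤ _ := by gcongr
  have h7 : |fmul d x y - x * y| ≤ u * (((1 + u) * |x|) * ((1 + u) * |y|)) +
      (u * |x| * ((1 + u) * |y|) + |x| * (u * |y|)) := by
    calc _ = |(fmul d x y - rnd d x * rnd d y) + (rnd d x * rnd d y - x * y)| := by ring_nf
      _ ≤ _ := (abs_add_le _ _).trans (add_le_add (h3.trans (by rw [abs_mul]; gcongr)) h6)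
  refine h7.trans ?_
  have : 0 ≤ |x| * |y| := by positivity
  have h8 : u * (1 + u) * (1 + u) + u * (1 + u) + u ≤ 3.06 * u := by
    have : u * u ≤ 1 / 64 * u := by gcongr
    have : u * u * u ≤ 1 / 64 * u := by nlinarith
    nlinarith
  calc _ = (u * (1 + u) * (1 + u) + u * (1 + u) + u) * (|x| * |y|) := by ring
    _ ≤ _ := by gcongr

lemma norm_cadd_sub_le {d : ℤ} (hu : (2 : ℝ) ^ (-d) ≤ 1 / 64) (a b : ℂ) :
    ‖cadd d a b - (a + b)‖ ≤ 4.04 * (2 : ℝ) ^ (-d) * (‖a‖ + ‖b‖) := by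
  have h1 := abs_fadd_sub_le hu a.re b.re
  have h2 := abs_fadd_sub_le hu a.im b.im
  set u := (2 : ℝ) ^ (-d)
  have hu0 : 0 < u := by positivity
  have h3 := Complex.norm_le_abs_re_add_abs_im (cadd d a b - (a + b))
  simp only [cadd, Complex.sub_re, Complex.sub_im, Complex.add_re, Complex.add_im] at h3
  have h4 : 2.02 * u * (|a.re| + |b.re|) ≤ 2.02 * u * (‖a‖ + ‖b‖) := by
    gcongr <;> exact Complex.abs_re_le_norm _
  have h5 : 2.02 * u * (|a.im| + |b.im|) ≤ 2.02 * u * (‖a‖ + ‖b‖) := by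
    gcongr <;> exact Complex.abs_im_le_norm _
  simp only [cadd]
  linarith

lemma norm_cmul_sub_le {d : ℤ} (hu : (2 : ℝ) ^ (-d) ≤ 1 / 64) (a b : ℂ) :
    ‖cmul d a b - a * b‖ ≤ 10.5 * (2 : ℝ) ^ (-d) * (‖a‖ * ‖b‖) := by
  -- Here p and q are computed products and x and y the exact ones: 2.02(1 + 3.06/64) + 3.06 < 5.2.
  have key : ∀ p q x y : ℝ, |p - x| ≤ 3.06 * (2 : ℝ) ^ (-d) * |x| →
      |q - y| ≤ 3.06 * (2 : ℝ) ^ (-d) * |y| →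
      2.02 * (2 : ℝ) ^ (-d) * (|p| + |q|) + (|p - x| + |q - y|) ≤
        5.2 * (2 : ℝ) ^ (-d) * (|x| + |y|) := by
    intro p q x y h1 h2
    set u := (2 : ℝ) ^ (-d)
    have hu0 : 0 < u := by positivity
    have h3 : |p| ≤ (1 + 3.06 * u) * |x| := by
      calc _ = |(p - x) + x| := by ring_nf
        _ ≤ _ := (abs_add_le _ _).trans (by linarith)
    have h4 : |q| ≤ (1 + 3.06 * u) * |y| := by
      calc _ = |(q - y) + y| := by ring_nf
        _ ≤ _ := (abs_add_le _ _).trans (by linarith)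
    have h5 : 2.02 * u * (|p| + |q|) ≤ 2.02 * u * ((1 + 3.06 * u) * |x| + (1 + 3.06 * u) * |y|) := by
      gcongr
    have h6 : 0 ≤ u * (|x| + |y|) := by positivity
    nlinarith
  have m1 := abs_fmul_sub_le hu a.re b.re
  have m2 := abs_fmul_sub_le hu a.im b.im
  have m3 := abs_fmul_sub_le hu a.re b.im
  have m4 := abs_fmul_sub_le hu a.im b.re
  rw [← abs_mul] at m1 m2 m3 m4
  have s1 := abs_fsub_sub_le hu (fmul d a.re b.re) (fmul d a.im b.im)
  have s2 := abs_fadd_sub_le hu (fmul d a.re b.im) (fmul d a.im b.re)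
  have k1 := key _ _ _ _ m1 m2
  have k2 := key _ _ _ _ m3 m4
  set u := (2 : ℝ) ^ (-d)
  have hu0 : 0 < u := by positivity
  have e1 : |fsub d (fmul d a.re b.re) (fmul d a.im b.im) - (a.re * b.re - a.im * b.im)| ≤
      5.2 * u * (|a.re * b.re| + |a.im * b.im|) := by
    refine le_trans ?_ k1
    calc _ = |(fsub d (fmul d a.re b.re) (fmul d a.im b.im) -
          (fmul d a.re b.re - fmul d a.im b.im)) + ((fmul d a.re b.re - a.re * b.re) -
          (fmul d a.im b.im - a.im * b.im))| := by ring_nf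
      _ ≤ _ := (abs_add_le _ _).trans (add_le_add s1 (abs_sub _ _))
  have e2 : |fadd d (fmul d a.re b.im) (fmul d a.im b.re) - (a.re * b.im + a.im * b.re)| ≤
      5.2 * u * (|a.re * b.im| + |a.im * b.re|) := by
    refine le_trans ?_ k2
    calc _ = |(fadd d (fmul d a.re b.im) (fmul d a.im b.re) -
          (fmul d a.re b.im + fmul d a.im b.re)) + ((fmul d a.re b.im - a.re * b.im) +
          (fmul d a.im b.re - a.im * b.re))| := by ring_nf
      _ ≤ _ := (abs_add_le _ _).trans (add_le_add s2 (abs_add_le _ _))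
  have h3 := Complex.norm_le_abs_re_add_abs_im (cmul d a b - a * b)
  simp only [cmul, Complex.sub_re, Complex.sub_im, Complex.mul_re, Complex.mul_im] at h3
  -- The left side factors as (|Re a| + |Im a|)(|Re b| + |Im b|), and each factor is at most √2
  -- times the norm. Hence the final constant 2 · 5.2 ≤ 10.5.
  have h4 : |a.re * b.re| + |a.im * b.im| + (|a.re * b.im| + |a.im * b.re|) ≤
      2 * (‖a‖ * ‖b‖) := by
    have ha : |a.re| ^ 2 + |a.im| ^ 2 = ‖a‖ ^ 2 := by
      rw [sq_abs, sq_abs, Complex.sq_norm, Complex.normSq_apply]; ring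
    have hb : |b.re| ^ 2 + |b.im| ^ 2 = ‖b‖ ^ 2 := by
      rw [sq_abs, sq_abs, Complex.sq_norm, Complex.normSq_apply]; ring
    simp only [abs_mul]
    have hab : 0 ≤ ‖a‖ * ‖b‖ := by positivity
    refine abs_le_of_sq_le_sq' ?_ (by positivity) |>.2
    have h1 : (|a.re| + |a.im|) ^ 2 ≤ 2 * ‖a‖ ^ 2 := by nlinarith [sq_nonneg (|a.re| - |a.im|)]
    have h2 : (|b.re| + |b.im|) ^ 2 ≤ 2 * ‖b‖ ^ 2 := by nlinarith [sq_nonneg (|b.re| - |b.im|)]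
    calc _ = (|a.re| + |a.im|) ^ 2 * (|b.re| + |b.im|) ^ 2 := by ring
      _ ≤ (2 * ‖a‖ ^ 2) * (2 * ‖b‖ ^ 2) := by gcongr
      _ = _ := by ring
  have h5 : 5.2 * u * (|a.re * b.re| + |a.im * b.im| + (|a.re * b.im| + |a.im * b.re|)) ≤
      5.2 * u * (2 * (‖a‖ * ‖b‖)) := by gcongr
  have h6 : 0 ≤ u * (‖a‖ * ‖b‖) := by positivity
  simp only [cmul]
  linarith

/-! ### Holomorphic parameter integrals and shifting lines of integration -/

section Analysis

open MeasureTheory Set Filter Topology Complex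

/-- A holomorphic family of functions with a common integrable bound has a holomorphic integral. -/
theorem differentiableOn_integral_of_dominated {α : Type*} [MeasurableSpace α] {μ : Measure α}
    {F : ℂ → α → ℂ} {U : Set ℂ} (hU : IsOpen U) {bound : α → ℝ}
    (hmeas : ∀ z ∈ U, AEStronglyMeasurable (F z) μ)
    (hdiff : ∀ᵐ a ∂μ, DifferentiableOn ℂ (fun z => F z a) U)
    (hbound : ∀ᵐ a ∂μ, ∀ z ∈ U, ‖F z a‖ ≤ bound a) (hint : Integrable bound μ) :
    DifferentiableOn ℂ (fun z => ∫ a, F z a ∂μ) U := by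
  intro z₀ hz₀
  obtain ⟨δ, hδ, hball⟩ := Metric.isOpen_iff.1 hU z₀ hz₀
  have hsub : ∀ z ∈ Metric.ball z₀ (δ / 2), Metric.closedBall z (δ / 4) ⊆ U := by
    intro z hz w hw
    apply hball
    rw [Metric.mem_ball] at hz ⊢
    rw [Metric.mem_closedBall] at hw
    linarith [dist_triangle w z z₀]
  have hderiv : ∀ᵐ a ∂μ, ∀ z ∈ Metric.ball z₀ (δ / 2),
      HasDerivAt (fun z => F z a) (deriv (fun z => F z a) z) z := by
    filter_upwards [hdiff] with a ha z hz
    exact ((ha z (hsub z hz (Metric.mem_closedBall_self (by positivity)))).differentiableAt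
      (hU.mem_nhds (hsub z hz (Metric.mem_closedBall_self (by positivity))))).hasDerivAt
  refine ((hasDerivAt_integral_of_dominated_loc_of_deriv_le (F := F)
    (F' := fun z a => deriv (fun z => F z a) z) (bound := fun a => bound a / (δ / 4))
    (Metric.ball_mem_nhds z₀ (half_pos hδ)) ?_ ?_ ?_ ?_ ?_
    hderiv).2.differentiableAt).differentiableWithinAt
  · filter_upwards [hU.mem_nhds hz₀] with z hz using hmeas z hz
  · exact hint.mono' (hmeas z₀ hz₀) (hbound.mono fun a ha => ha z₀ hz₀)
  -- Measurability of the derivative: it is a pointwise limit of difference quotients along a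
  -- sequence tending to z₀ inside U.
  · have hlim : Tendsto (fun n : ℕ => z₀ + ((δ / 2 / (n + 2) : ℝ) : ℂ)) atTop (𝓝[≠] z₀) := by
      rw [tendsto_nhdsWithin_iff]
      constructor
      · have h1 : Tendsto (fun n : ℕ => δ / 2 / ((n : ℝ) + 2)) atTop (𝓝 0) :=
          tendsto_const_nhds.div_atTop
            (tendsto_atTop_add_const_right _ _ tendsto_natCast_atTop_atTop)
        have h2 := (continuous_ofReal.tendsto (0 : ℝ)).comp h1
        simpa using h2.const_add z₀
      · refine Eventually.of_forall fun n => ?_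
        have : δ / 2 / ((n : ℝ) + 2) ≠ 0 := by positivity
        rw [mem_compl_singleton_iff, Ne, add_eq_left, ofReal_eq_zero]
        exact this
    refine aestronglyMeasurable_of_tendsto_ae atTop
      (f := fun (n : ℕ) a => slope (fun z => F z a) z₀ (z₀ + ((δ / 2 / (n + 2) : ℝ) : ℂ))) ?_ ?_
    · intro n
      simp only [slope_def_module]
      have hmem : z₀ + ((δ / 2 / (n + 2) : ℝ) : ℂ) ∈ U := by
        apply hball
        rw [Metric.mem_ball, dist_eq_norm, add_sub_cancel_left, norm_real, Real.norm_eq_abs,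
        abs_of_pos (by positivity)]
        have : (0 : ℝ) ≤ n := n.cast_nonneg
        rw [div_lt_iff₀ (by positivity)]
        nlinarith
      have hm := (hmeas _ hmem).sub (hmeas _ hz₀)
      exact hm.const_smul (z₀ + ((δ / 2 / (n + 2) : ℝ) : ℂ) - z₀)⁻¹
    · filter_upwards [hderiv] with a ha
      exact (hasDerivAt_iff_tendsto_slope.1 (ha z₀ (Metric.mem_ball_self (by positivity)))).comp
        hlim
  -- Cauchy's estimate on circles of radius δ/4 turns the bound for the function into one for its
  -- derivative.
  · filter_upwards [hdiff, hbound] with a ha hb z hz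
    refine norm_deriv_le_of_forall_mem_sphere_norm_le (by positivity) ?_ fun w hw =>
      hb w (hsub z hz (Metric.sphere_subset_closedBall hw))
    refine DifferentiableOn.diffContOnCl ?_
    rw [closure_ball _ (by positivity)]
    exact ha.mono (hsub z hz)
  · exact hint.div_const _

lemma integrable_exp_neg_abs : Integrable fun x : ℝ => Real.exp (-|x|) := by
  rw [← integrableOn_univ, ← Iic_union_Ioi (a := (0 : ℝ)), integrableOn_union]
  constructor
  · refine (integrableOn_exp_Iic 0).congr_fun (fun x hx => ?_) measurableSet_Iic
    simp only [abs_of_nonpos (mem_Iic.1 hx), neg_neg]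
  · refine (integrableOn_exp_neg_Ioi 0).congr_fun (fun x hx => ?_) measurableSet_Ioi
    simp only [abs_of_pos (mem_Ioi.1 hx)]

lemma integrable_of_exp_decay {g : ℝ → ℂ} (hg : Continuous g) {C R : ℝ}
    (h : ∀ x, R ≤ |x| → ‖g x‖ ≤ C * Real.exp (-|x|)) : Integrable g := by
  have hO : ∀ l : Filter ℝ, (∀ᶠ x in l, R ≤ |x|) → g =O[l] fun x : ℝ => Real.exp (-|x|) := by
    intro l hl
    refine Asymptotics.IsBigO.of_bound C ?_
    filter_upwards [hl] with x hx
    simpa using h x hx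
  exact hg.locallyIntegrable.integrable_of_isBigO_atBot_atTop
    (hO _ (tendsto_abs_atBot_atTop.eventually_ge_atTop R)) (integrable_exp_neg_abs.integrableAtFilter _)
    (hO _ (tendsto_abs_atTop_atTop.eventually_ge_atTop R)) (integrable_exp_neg_abs.integrableAtFilter _)

/-- Shifting a horizontal line of integration across a strip of holomorphy. -/
lemma integral_horizontal_line_eq {F : ℂ → ℂ} {a b : ℝ} (hab : a ≤ b)
    (hc : ContinuousOn F {z | z.im ∈ Icc a b}) (hd : DifferentiableOn ℂ F {z | z.im ∈ Ioo a b})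
    {C R : ℝ} (h : ∀ z : ℂ, z.im ∈ Icc a b → R ≤ |z.re| → ‖F z‖ ≤ C * Real.exp (-|z.re|)) :
    ∫ x : ℝ, F (x + a * I) = ∫ x : ℝ, F (x + b * I) := by
  have hline : ∀ c ∈ Icc a b, Integrable fun x : ℝ => F (x + c * I) := by
    intro c hcab
    refine integrable_of_exp_decay (C := C) (R := R) ?_ fun x hx => ?_
    · exact hc.comp_continuous (by fun_prop) fun x => by simpa using hcab
    · simpa using h (x + c * I) (by simpa using hcab) (by simpa using hx)
  have hia := intervalIntegral_tendsto_integral (hline a (left_mem_Icc.2 hab))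
    tendsto_neg_atTop_atBot tendsto_id
  have hib := intervalIntegral_tendsto_integral (hline b (right_mem_Icc.2 hab))
    tendsto_neg_atTop_atBot tendsto_id
  -- The vertical sides vanish in the limit; f is the identity for the right side and negation for
  -- the left.
  have hside : ∀ f : ℝ → ℝ, (∀ x, |f x| = |x|) →
      Tendsto (fun x : ℝ => I • ∫ y : ℝ in a..b, F (f x + y * I)) atTop (𝓝 0) := by
    intro f hf
    have h0 : Tendsto (fun x : ℝ => C * Real.exp (-x) * |b - a|) atTop (𝓝 0) := by
      simpa using (Real.tendsto_exp_neg_atTop_nhds_zero.const_mul C).mul_const |b - a|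
    refine squeeze_zero_norm' ?_ h0
    filter_upwards [eventually_ge_atTop R, eventually_ge_atTop 0] with x hx hx0
    rw [norm_smul, norm_I, one_mul]
    refine intervalIntegral.norm_integral_le_of_norm_le_const fun y hy => ?_
    rw [uIoc_of_le hab] at hy
    have := h (f x + y * I) (by simpa using ⟨hy.1.le, hy.2⟩) (by simpa [hf, abs_of_nonneg hx0] using hx)
    simpa [hf, abs_of_nonneg hx0] using this
  have hrect : ∀ x : ℝ, 0 ≤ x → (∫ u : ℝ in -x..x, F (u + a * I)) -
      (∫ u : ℝ in -x..x, F (u + b * I)) + I • (∫ y : ℝ in a..b, F (x + y * I)) -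
      I • (∫ y : ℝ in a..b, F ((-x : ℝ) + y * I)) = 0 := by
    intro x hx
    have := integral_boundary_rect_eq_zero_of_continuousOn_of_differentiableOn F
      ⟨-x, a⟩ ⟨x, b⟩ ?_ ?_
    · simpa using this
    · refine hc.mono fun z hz => ?_
      rw [mem_reProdIm] at hz
      simpa [uIcc_of_le hab] using hz.2
    · refine hd.mono fun z hz => ?_
      rw [mem_reProdIm] at hz
      simpa [min_eq_left hab, max_eq_right hab] using hz.2
  have hlim := ((hia.sub hib).add (hside id fun x => rfl)).sub (hside (fun x => -x) abs_neg)
  have h0 : Tendsto (fun _ : ℝ => (0 : ℂ)) atTop (𝓝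
      ((∫ x : ℝ, F (x + a * I)) - (∫ x : ℝ, F (x + b * I)) + 0 - 0)) := by
    refine hlim.congr' ?_
    filter_upwards [eventually_ge_atTop 0] with x hx
    simpa using hrect x hx
  have := tendsto_nhds_unique h0 tendsto_const_nhds
  rw [add_zero, sub_zero] at this
  exact sub_eq_zero.1 this

/-! ### Rotated lines, the kernel e^{πix} − e^{−πix}, and Gaussian bounds -/

/-- The primitive eighth root of unity `exp (π i / 4)`. -/
noncomputable def omega : ℂ := exp (Real.pi * I / 4)

lemma omega_eq : omega = ((Real.sqrt 2 / 2 : ℝ) : ℂ) * (1 + I) := by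
  rw [omega, show (Real.pi * I / 4 : ℂ) = ((Real.pi / 4 : ℝ) : ℂ) * I by push_cast; ring,
    exp_mul_I, ← ofReal_cos, ← ofReal_sin, Real.cos_pi_div_four, Real.sin_pi_div_four]
  ring

lemma omega_sq : omega ^ 2 = I := by
  rw [omega, ← exp_nat_mul]
  rw [show ((2 : ℕ) : ℂ) * (Real.pi * I / 4) = Real.pi / 2 * I by push_cast; ring,
    exp_pi_div_two_mul_I]

lemma omega_re : omega.re = Real.sqrt 2 / 2 := by rw [omega_eq]; simp

lemma omega_im : omega.im = Real.sqrt 2 / 2 := by rw [omega_eq]; simp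

lemma norm_omega : ‖omega‖ = 1 := by
  rw [omega, show (Real.pi * I / 4 : ℂ) = ((Real.pi / 4 : ℝ) : ℂ) * I by push_cast; ring,
    norm_exp_ofReal_mul_I]

lemma omega_ne_zero : omega ≠ 0 := exp_ne_zero _

lemma omega_pow_three : omega ^ 3 = I * omega := by rw [pow_succ, omega_sq]

/-- The denominator `exp (π i x) - exp (-π i x)`. -/
noncomputable def sinKernel (x : ℂ) : ℂ := exp (Real.pi * I * x) - exp (-(Real.pi * I * x))

lemma sinKernel_eq (x : ℂ) : sinKernel x = 2 * I * sin (Real.pi * x) := by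
  rw [sinKernel, sin, show -(Real.pi * x : ℂ) * I = -(Real.pi * I * x) by ring,
    show (Real.pi * x : ℂ) * I = Real.pi * I * x by ring]
  linear_combination (exp (Real.pi * I * x) - exp (-(Real.pi * I * x))) * I_sq

lemma sinKernel_eq_zero_iff (x : ℂ) : sinKernel x = 0 ↔ ∃ n : ℤ, x = n := by
  rw [sinKernel_eq, mul_eq_zero_iff_left (by simp), sin_eq_zero_iff]
  have hpi : (Real.pi : ℂ) ≠ 0 := ofReal_ne_zero.2 Real.pi_ne_zero
  refine exists_congr fun n => ⟨fun h => ?_, fun h => by rw [h]; ring⟩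
  exact mul_left_cancel₀ hpi (by rw [h]; ring)

lemma sinKernel_add_one (x : ℂ) : sinKernel (x + 1) = -sinKernel x := by
  rw [sinKernel_eq, sinKernel_eq, mul_add, mul_one, sin_add_pi]; ring

lemma sinKernel_neg (x : ℂ) : sinKernel (-x) = -sinKernel x := by
  rw [sinKernel_eq, sinKernel_eq, mul_neg, sin_neg]; ring

lemma differentiable_sinKernel : Differentiable ℂ sinKernel := by
  unfold sinKernel; fun_prop

/-- Away from the real axis one exponential has norm at most 1 and the other at least e^π > 2. So
the denominator can be dropped from decay estimates. -/
lemma one_le_norm_sinKernel {x : ℂ} (hx : 1 ≤ |x.im|) : 1 ≤ ‖sinKernel x‖ := by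
  wlog h : 0 ≤ x.im generalizing x
  · rw [← norm_neg, ← sinKernel_neg]
    exact this (by simpa using hx) (by simp; linarith)
  rw [abs_of_nonneg h] at hx
  have h1 : ‖exp (Real.pi * I * x)‖ ≤ 1 := by
    rw [norm_exp]; simp
    positivity
  have h2 : 2 ≤ ‖exp (-(Real.pi * I * x))‖ := by
    rw [norm_exp]; simp
    have := Real.add_one_le_exp (Real.pi * x.im)
    nlinarith [Real.pi_gt_three]
  have := norm_sub_norm_le (exp (-(Real.pi * I * x))) (exp (Real.pi * I * x))
  rw [sinKernel, norm_sub_rev]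
  linarith

/-- A Gaussian beats every linear exponential. -/
lemma exp_linear_sub_sq_le (K u : ℝ) :
    Real.exp (K * |u| - Real.pi * u ^ 2) ≤ Real.exp ((K + 1) ^ 2) * Real.exp (-|u|) := by
  rw [← Real.exp_add]
  gcongr
  have := Real.pi_gt_three
  rw [← sq_abs u]
  nlinarith [sq_nonneg (|u| - (K + 1)), sq_nonneg |u|]

lemma sqrt_two_div_two_bounds : (0.7 : ℝ) ≤ √2 / 2 ∧ √2 / 2 ≤ 0.71 := by
  constructor
  · have : (1.4 : ℝ) ≤ √2 := Real.le_sqrt_of_sq_le (by norm_num)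
    linarith
  · have : √2 ≤ (1.42 : ℝ) := Real.sqrt_le_iff.2 ⟨by norm_num, by norm_num⟩
    linarith

/-- In the coordinate z = x/w the slanted line is the horizontal line Im z = q, to which
`integral_horizontal_line_eq` applies; translation invariance removes p. -/
lemma integral_line_eq_of_eq_mul {F : ℂ → ℂ} {c w : ℂ} {p q : ℝ} (h : c = w * (p + q * I)) :
    ∫ r : ℝ, F (c + w * r) = ∫ r : ℝ, F (w * (r + q * I)) := by
  rw [← integral_add_right_eq_self (fun r : ℝ => F (w * (r + q * I))) p]
  congr 1; funext r; rw [h]; push_cast; ring_nf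

lemma integrable_line_of_eq_mul {F : ℂ → ℂ} {c w : ℂ} {p q : ℝ} (h : c = w * (p + q * I))
    (hF : Integrable fun r : ℝ => F (w * (r + q * I))) : Integrable fun r : ℝ => F (c + w * r) := by
  have := hF.comp_add_right p
  refine this.congr (Eventually.of_forall fun r => ?_)
  simp only
  rw [h]; push_cast; ring_nf

lemma norm_exp_quadratic_le (c : ℂ) {z : ℂ} (hz : |z.im| ≤ 1) :
    ‖exp (-Real.pi * z ^ 2 + c * z)‖ ≤
      Real.exp (‖c‖ + Real.pi) * Real.exp ((‖c‖ + 1) ^ 2) * Real.exp (-|z.re|) := by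
  rw [mul_assoc]
  refine le_trans ?_ (mul_le_mul_of_nonneg_left (exp_linear_sub_sq_le ‖c‖ z.re) (Real.exp_nonneg _))
  rw [← Real.exp_add, norm_exp]
  gcongr
  have h1 : (c * z).re ≤ ‖c‖ * (|z.re| + 1) := by
    refine (re_le_norm _).trans ?_
    rw [norm_mul]
    gcongr
    exact (norm_le_abs_re_add_abs_im z).trans (by linarith)
  have h2 : (-(Real.pi : ℂ) * z ^ 2).re = -Real.pi * (z.re ^ 2 - z.im ^ 2) := by
    rw [← ofReal_neg, re_ofReal_mul, pow_two, mul_re]; ring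
  have h3 : z.im ^ 2 ≤ 1 := by rw [← sq_abs]; exact pow_le_one₀ (abs_nonneg _) hz
  rw [add_re, h2]
  nlinarith [Real.pi_pos]

/-! ### Mordell's integral -/

/-- The integrand of Mordell's integral. -/
noncomputable def mordell (y x : ℂ) : ℂ :=
  exp (-(Real.pi * I * x ^ 2) + 2 * Real.pi * I * x * y) / sinKernel x

lemma omega_pow_three_re : (omega ^ 3).re = -(√2 / 2) := by
  rw [omega_pow_three]; simp [omega_im]

lemma omega_pow_three_im : (omega ^ 3).im = √2 / 2 := by
  rw [omega_pow_three]; simp [omega_re]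

lemma omega_pow_four : omega ^ 4 = -1 := by
  rw [show (4 : ℕ) = 2 * 2 by rfl, pow_mul, omega_sq, I_sq]

lemma ofReal_eq_omega_pow_three_mul (c : ℝ) :
    (c : ℂ) = omega ^ 3 * (((-(c * (√2 / 2)) : ℝ) : ℂ) + ((-(c * (√2 / 2)) : ℝ) : ℂ) * I) := by
  have h : ((-(c * (√2 / 2)) : ℝ) : ℂ) + ((-(c * (√2 / 2)) : ℝ) : ℂ) * I = -c * omega := by
    rw [omega_eq]; push_cast; ring
  rw [h]
  linear_combination (c : ℂ) * omega_pow_four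

lemma mordell_numerator_eq (y z : ℂ) :
    exp (-(Real.pi * I * (omega ^ 3 * z) ^ 2) + 2 * Real.pi * I * (omega ^ 3 * z) * y) =
      exp (-Real.pi * z ^ 2 + 2 * Real.pi * I * omega ^ 3 * y * z) := by
  congr 1
  have : (omega ^ 3) ^ 2 = -I := by
    rw [← pow_mul, mul_comm, pow_mul, omega_sq, pow_succ, I_sq]; ring
  linear_combination (-(Real.pi * I * z ^ 2) : ℂ) * this + Real.pi * z ^ 2 * I_sq

lemma mordell_decay (y : ℂ) : ∃ C : ℝ, ∀ z : ℂ, |z.im| ≤ √2 / 4 → 3 ≤ |z.re| →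
    ‖mordell y (omega ^ 3 * z)‖ ≤ C * Real.exp (-|z.re|) := by
  refine ⟨Real.exp (‖2 * Real.pi * I * omega ^ 3 * y‖ + Real.pi) *
    Real.exp ((‖2 * Real.pi * I * omega ^ 3 * y‖ + 1) ^ 2), fun z hz hz3 => ?_⟩
  have hs := sqrt_two_div_two_bounds
  have h1 := norm_exp_quadratic_le (2 * Real.pi * I * omega ^ 3 * y) (z := z) (by linarith)
  rw [mordell, norm_div, mordell_numerator_eq]
  refine (div_le_self (norm_nonneg _) (one_le_norm_sinKernel ?_)).trans h1
  rw [mul_im, omega_pow_three_re, omega_pow_three_im,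
    show -(√2 / 2) * z.im + √2 / 2 * z.re = √2 / 2 * (z.re - z.im) by ring, abs_mul,
    abs_of_pos (by linarith)]
  have := abs_sub_abs_le_abs_sub z.re z.im
  nlinarith

lemma line_not_int {c : ℝ} (hc : ∀ n : ℤ, c ≠ n) {w : ℂ} (hw : w.im ≠ 0) (r : ℝ) (n : ℤ) :
    (c : ℂ) + w * r ≠ n := by
  intro h
  have him := congrArg im h
  have hre := congrArg re h
  simp at him hre
  rcases him with him | him
  · exact hw him
  · rw [him] at hre
    exact hc n (by simpa using hre)

lemma half_ne_int (n : ℤ) : (1 / 2 : ℝ) ≠ n := by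
  intro h
  have h2 : (1 : ℝ) = 2 * n := by linarith
  have h3 : (1 : ℤ) = 2 * n := by exact_mod_cast h2
  omega

lemma neg_half_ne_int (n : ℤ) : (-(1 / 2) : ℝ) ≠ n := by
  intro h
  exact half_ne_int (-n) (by push_cast; linarith)

lemma omega_pow_three_im_ne_zero : (omega ^ 3).im ≠ 0 := by
  rw [omega_pow_three_im]; positivity

lemma integrable_mordell {c : ℝ} (hc : ∀ n : ℤ, c ≠ n) (hc2 : |c| ≤ 1 / 2) (y : ℂ) :
    Integrable fun r : ℝ => mordell y (c + omega ^ 3 * r) := by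
  refine integrable_line_of_eq_mul (ofReal_eq_omega_pow_three_mul c) ?_
  obtain ⟨C, hC⟩ := mordell_decay y
  refine integrable_of_exp_decay (C := C) (R := 3) ?_ fun r hr => ?_
  · unfold mordell
    refine Continuous.div (by fun_prop) (differentiable_sinKernel.continuous.comp (by fun_prop)) ?_
    intro r hr
    obtain ⟨n, hn⟩ := (sinKernel_eq_zero_iff _).1 hr
    refine line_not_int hc omega_pow_three_im_ne_zero (r - -(c * (√2 / 2))) n ?_
    rw [← hn]
    nth_rewrite 1 [ofReal_eq_omega_pow_three_mul c]
    push_cast; ring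
  · have := hC (r + ((-(c * (√2 / 2)) : ℝ) : ℂ) * I) ?_ (by simpa using hr)
    · simpa using this
    · have h2 := Real.sqrt_nonneg 2
      simp only [add_im, ofReal_im, mul_im, ofReal_re, I_im, I_re, mul_one, mul_zero, add_zero,
        zero_add, abs_neg, abs_mul]
      rw [abs_of_nonneg (by positivity : 0 ≤ √2 / 2)]
      nlinarith

lemma sinKernel_zero : sinKernel 0 = 0 := by simp [sinKernel]

lemma dslope_sinKernel_ne_zero {x : ℂ} (hx : ∀ n : ℤ, x = n → n = 0) :
    dslope sinKernel 0 x ≠ 0 := by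
  have hdK : deriv sinKernel 0 ≠ 0 := by
    have h1 : HasDerivAt sinKernel (Real.pi * I - -(Real.pi * I)) 0 := by
      have h2 : HasDerivAt (fun x : ℂ => (Real.pi * I : ℂ) * x) (Real.pi * I) 0 := by
        simpa using (hasDerivAt_id (0 : ℂ)).const_mul (Real.pi * I : ℂ)
      have h3 : HasDerivAt sinKernel _ 0 := h2.cexp.sub h2.neg.cexp
      convert h3 using 1
      simp
    rw [h1.deriv, sub_neg_eq_add, ← two_mul]
    simp
  rcases eq_or_ne x 0 with rfl | h
  · rw [dslope_same]; exact hdK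
  · rw [dslope_of_ne _ h, slope_def_field, sinKernel_zero, sub_zero, sub_zero]
    refine div_ne_zero (fun h0 => ?_) h
    obtain ⟨n, hn⟩ := (sinKernel_eq_zero_iff _).1 h0
    exact h (by rw [hn, hx n hn, Int.cast_zero])

lemma differentiable_dslope_zero {f : ℂ → ℂ} (hf : Differentiable ℂ f) :
    Differentiable ℂ (dslope f 0) := by
  rw [← differentiableOn_univ] at hf ⊢
  exact (differentiableOn_dslope univ_mem).2 hf

/-- The difference of two Mordell integrands extends holomorphically across `0`. -/
lemma integral_mordell_sub_eq (y : ℂ) :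
    (∫ r : ℝ, mordell y ((1 / 2 : ℝ) + omega ^ 3 * r)) -
        (∫ r : ℝ, mordell y ((-(1 / 2) : ℝ) + omega ^ 3 * r)) =
      (∫ r : ℝ, mordell 0 ((1 / 2 : ℝ) + omega ^ 3 * r)) -
        (∫ r : ℝ, mordell 0 ((-(1 / 2) : ℝ) + omega ^ 3 * r)) := by
  set E : ℂ → ℂ := fun x => exp (2 * Real.pi * I * x * y)
  set H : ℂ → ℂ := fun x => exp (-(Real.pi * I * x ^ 2)) * dslope E 0 x / dslope sinKernel 0 x
  have hs := sqrt_two_div_two_bounds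
  have hHeq : ∀ x, x ≠ 0 → H x = mordell y x - mordell 0 x := by
    intro x hx
    simp only [H, dslope_of_ne _ hx, slope_def_field, E, sinKernel_zero, mordell, exp_add]
    simp only [sub_zero, mul_zero, zero_mul, exp_zero, mul_one]
    rw [← sub_div, ← mul_sub_one, mul_div_assoc, mul_div_assoc, div_div_div_cancel_right₀ hx]
  -- In the coordinate z = x/ω³ this is the closed strip between the lines through −1/2 and 1/2; the
  -- only integer x in it is 0, where the zero of the kernel has been divided out.
  have hden : ∀ z : ℂ, z.im ∈ Icc (-(√2 / 4)) (√2 / 4) →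
      dslope sinKernel 0 (omega ^ 3 * z) ≠ 0 := by
    intro z hz
    refine dslope_sinKernel_ne_zero fun n hn => ?_
    have h1 : z = -n * omega := by
      have : omega ^ 4 * z = n * omega := by
        rw [← hn]; ring
      rw [omega_pow_four] at this
      linear_combination -this
    have h2 : z.im = -n * (√2 / 2) := by rw [h1]; simp [omega_im]
    rw [h2] at hz
    have h3 : (n : ℝ) < 1 := by nlinarith [hz.1]
    have h4 : (-1 : ℝ) < n := by nlinarith [hz.2]
    have : n < 1 := by exact_mod_cast h3
    have : -1 < n := by exact_mod_cast h4
    omega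
  have hnum : Differentiable ℂ fun z : ℂ =>
      exp (-(Real.pi * I * (omega ^ 3 * z) ^ 2)) * dslope E 0 (omega ^ 3 * z) := by
    refine Differentiable.mul (by fun_prop) ((differentiable_dslope_zero (f := E) (by fun_prop)).comp (by fun_prop))
  have hdd : Differentiable ℂ fun z : ℂ => dslope sinKernel 0 (omega ^ 3 * z) :=
    (differentiable_dslope_zero differentiable_sinKernel).comp (by fun_prop)
  have hdiff : DifferentiableOn ℂ (fun z => H (omega ^ 3 * z))
      {z | z.im ∈ Icc (-(√2 / 4)) (√2 / 4)} :=
    hnum.differentiableOn.div hdd.differentiableOn fun z hz => hden z hz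
  obtain ⟨C, hC⟩ := mordell_decay y
  obtain ⟨C', hC'⟩ := mordell_decay 0
  have hshift := integral_horizontal_line_eq (F := fun z => H (omega ^ 3 * z))
    (a := -(√2 / 4)) (b := √2 / 4) (C := C + C') (R := 3) (by linarith) hdiff.continuousOn
    (hdiff.mono fun z hz => ⟨hz.1.le, hz.2.le⟩) (by
      intro z hz hz3
      have hz0 : z ≠ 0 := by rintro rfl; norm_num at hz3
      rw [hHeq _ (mul_ne_zero (pow_ne_zero _ omega_ne_zero) hz0), add_mul]
      exact (norm_sub_le _ _).trans
        (add_le_add (hC z (abs_le.2 hz) hz3) (hC' z (abs_le.2 hz) hz3)))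
  have key : ∀ c : ℝ, (∀ n : ℤ, c ≠ n) → |c| ≤ 1 / 2 →
      ∫ r : ℝ, H (omega ^ 3 * (r + ((-(c * (√2 / 2)) : ℝ) : ℂ) * I)) =
        (∫ r : ℝ, mordell y (c + omega ^ 3 * r)) - ∫ r : ℝ, mordell 0 (c + omega ^ 3 * r) := by
    intro c hc hc2
    rw [← integral_line_eq_of_eq_mul (F := H) (ofReal_eq_omega_pow_three_mul c),
      ← integral_sub (integrable_mordell hc hc2 y) (integrable_mordell hc hc2 0)]
    congr 1; funext r
    refine hHeq _ ?_
    simpa using line_not_int hc omega_pow_three_im_ne_zero r 0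
  have k1 := key (1 / 2) half_ne_int (by norm_num)
  have k2 := key (-(1 / 2)) neg_half_ne_int (by norm_num)
  rw [show -((1 / 2 : ℝ) * (√2 / 2)) = -(√2 / 4) by ring] at k1
  rw [show -(-(1 / 2 : ℝ) * (√2 / 2)) = √2 / 4 by ring] at k2
  rw [← hshift] at k2
  rw [k1] at k2
  linear_combination k2

/-- Under x ↦ x + 1 the kernel changes sign and the exponential acquires elementary factors; the
combination chosen cancels the denominator and leaves a pure Gaussian. -/
lemma mordell_sub_mordell_add_one (y x : ℂ) (hx : sinKernel x ≠ 0) :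
    mordell y x - exp (-(2 * Real.pi * I * y)) * mordell y (x + 1) =
      exp (-(Real.pi * I * x ^ 2) + 2 * Real.pi * I * x * y - Real.pi * I * x) := by
  have h1 : exp (-(2 * Real.pi * I * y)) * exp (-(Real.pi * I * (x + 1) ^ 2) +
      2 * Real.pi * I * (x + 1) * y) = -(exp (-(Real.pi * I * x ^ 2) + 2 * Real.pi * I * x * y) *
        exp (-(2 * Real.pi * I * x))) := by
    have hneg : ∀ A : ℂ, -exp A = exp (A + -(Real.pi * I)) := fun A => by
      rw [exp_add, exp_neg, exp_pi_mul_I]; norm_num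
    rw [← exp_add, ← exp_add, hneg]
    congr 1; ring
  rw [mordell, mordell, sinKernel_add_one, mul_div_assoc', h1, neg_div_neg_eq, ← sub_div,
    div_eq_iff hx, sinKernel, mul_sub, ← exp_add, ← exp_add, ← exp_add]
  congr 2 <;> ring

lemma integral_gaussian_line (y : ℂ) :
    ∫ r : ℝ, exp (-(Real.pi * I * (((-(1 / 2) : ℝ) : ℂ) + omega ^ 3 * r) ^ 2) +
      2 * Real.pi * I * (((-(1 / 2) : ℝ) : ℂ) + omega ^ 3 * r) * y -
      Real.pi * I * (((-(1 / 2) : ℝ) : ℂ) + omega ^ 3 * r)) =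
    omega * exp (Real.pi * I * y ^ 2 - Real.pi * I * y) := by
  have hsq : (omega ^ 3) ^ 2 = -I := by
    rw [← pow_mul, mul_comm, pow_mul, omega_sq, pow_succ, I_sq]; ring
  have hpi : (Real.pi : ℂ) ≠ 0 := ofReal_ne_zero.2 Real.pi_ne_zero
  have h := integral_cexp_quadratic (b := (-Real.pi : ℂ)) (by simp [Real.pi_pos])
    (2 * Real.pi * I * omega ^ 3 * y) (Real.pi * I / 4 - Real.pi * I * y)
  rw [neg_neg, div_self hpi, one_cpow, one_mul] at h
  convert h using 1
  · congr 1; funext r; congr 1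
    push_cast
    linear_combination (-(Real.pi * I * r ^ 2) : ℂ) * hsq + Real.pi * r ^ 2 * I_sq
  · rw [omega, ← exp_add]
    congr 1
    have : (2 * Real.pi * I * omega ^ 3 * y) ^ 2 / (4 * -Real.pi) = -(Real.pi * I * y ^ 2) := by
      rw [div_eq_iff (by simp [hpi])]
      linear_combination 4 * Real.pi ^ 2 * I ^ 2 * y ^ 2 * hsq - 4 * Real.pi ^ 2 * I * y ^ 2 * I_sq
    rw [← omega, this]; ring

/-- Mordell's integral. -/
theorem integral_mordell (y : ℂ) :
    omega ^ 3 * (∫ r : ℝ, mordell y ((1 / 2 : ℝ) + omega ^ 3 * r)) *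
        (1 - exp (-(2 * Real.pi * I * y))) =
      1 - exp (Real.pi * I * y ^ 2 - Real.pi * I * y) := by
  have hfe : ∀ y : ℂ, (∫ r : ℝ, mordell y ((-(1 / 2) : ℝ) + omega ^ 3 * r)) -
      exp (-(2 * Real.pi * I * y)) * (∫ r : ℝ, mordell y ((1 / 2 : ℝ) + omega ^ 3 * r)) =
      omega * exp (Real.pi * I * y ^ 2 - Real.pi * I * y) := by
    intro y
    rw [← integral_gaussian_line, ← integral_const_mul, ← integral_sub
      (integrable_mordell neg_half_ne_int (by norm_num) y)
      ((integrable_mordell half_ne_int (by norm_num) y).const_mul _)]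
    congr 1; funext r
    rw [← mordell_sub_mordell_add_one y]
    · congr 3; push_cast; ring
    · intro h
      obtain ⟨n, hn⟩ := (sinKernel_eq_zero_iff _).1 h
      exact line_not_int neg_half_ne_int omega_pow_three_im_ne_zero r n hn
  have h1 := hfe y
  -- At y = 0 the relation evaluates the y-independent difference of the two line integrals as ω,
  -- which replaces a residue computation.
  have h0 := hfe 0
  have hD := integral_mordell_sub_eq y
  simp only [mul_zero, neg_zero, exp_zero, one_mul, ne_eq, OfNat.ofNat_ne_zero, not_false_eq_true,
    zero_pow, sub_zero, mul_one] at h0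
  have h4 := omega_pow_four
  linear_combination omega ^ 3 * (hD + h1 - h0) +
    (exp (Real.pi * I * y ^ 2 - Real.pi * I * y) - 1) * h4

/-! ### Riemann's auxiliary function: entirety and reduction to a ray -/

lemma rzetaIntegrand_def (s x : ℂ) :
    rzetaIntegrand s x = x ^ (-s) * (exp (Real.pi * I * x ^ 2) / sinKernel x) := by
  rw [rzetaIntegrand, sinKernel, mul_div_assoc]

lemma norm_cpow_le_exp_norm_log {x : ℂ} (hx : x ≠ 0) (s : ℂ) {K : ℝ} (hs : ‖s‖ ≤ K) :
    ‖x ^ (-s)‖ ≤ Real.exp (K * ‖log x‖) := by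
  rw [cpow_def_of_ne_zero hx]
  refine (norm_exp_le_exp_norm _).trans ?_
  gcongr
  rw [norm_mul, norm_neg, mul_comm]
  gcongr

/-- The power x^{−s} is replaced by its majorant exp(K‖log x‖), so one estimate serves all ‖s‖ ≤ K,
as holomorphy in s requires. Along the line ‖log x‖ grows at most linearly, and the Gaussian wins.
-/
lemma rzeta_kernel_decay {K : ℝ} (hK : 0 ≤ K) : ∃ C : ℝ, ∀ z : ℂ, |z.im| ≤ √2 / 4 → 3 ≤ |z.re| →
    Real.exp (K * ‖log (-omega * z)‖) *
      ‖exp (Real.pi * I * (-omega * z) ^ 2) / sinKernel (-omega * z)‖ ≤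
    C * Real.exp (-|z.re|) := by
  refine ⟨Real.exp (K * (1 + Real.pi) + Real.pi) * Real.exp ((K + 1) ^ 2), fun z hz hz3 => ?_⟩
  have hs := sqrt_two_div_two_bounds
  have hzn : ‖z‖ ≤ |z.re| + 1 := (norm_le_abs_re_add_abs_im z).trans (by linarith)
  have hz1 : 1 ≤ ‖z‖ := by linarith [abs_re_le_norm z]
  have hlog : ‖log (-omega * z)‖ ≤ |z.re| + (1 + Real.pi) := by
    have h1 : ‖-omega * z‖ = ‖z‖ := by rw [norm_mul, norm_neg, norm_omega, one_mul]
    refine (norm_le_abs_re_add_abs_im _).trans ?_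
    rw [log_re, log_im, h1, abs_of_nonneg (Real.log_nonneg hz1)]
    linarith [abs_arg_le_pi (-omega * z), Real.log_le_self (norm_nonneg z)]
  have hexp : ‖exp (Real.pi * I * (-omega * z) ^ 2)‖ ≤ Real.exp (Real.pi - Real.pi * z.re ^ 2) := by
    have h2 : Real.pi * I * (-omega * z) ^ 2 = ((-Real.pi : ℝ) : ℂ) * z ^ 2 := by
      rw [mul_pow, neg_sq, omega_sq]; push_cast
      linear_combination Real.pi * z ^ 2 * I_sq
    have h3 : z.im ^ 2 ≤ 1 := by
      rw [← sq_abs]; exact pow_le_one₀ (abs_nonneg _) (by linarith)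
    rw [h2, norm_exp, re_ofReal_mul, pow_two, mul_re]
    gcongr
    nlinarith [Real.pi_pos]
  have hker : 1 ≤ ‖sinKernel (-omega * z)‖ := by
    refine one_le_norm_sinKernel ?_
    rw [mul_im, neg_re, neg_im, omega_re, omega_im,
      show -(√2 / 2) * z.im + -(√2 / 2) * z.re = -(√2 / 2 * (z.re + z.im)) by ring, abs_neg, abs_mul,
      abs_of_pos (by linarith)]
    have := abs_sub_abs_le_abs_sub z.re (-z.im)
    rw [abs_neg, sub_neg_eq_add] at this
    nlinarith
  calc _ ≤ Real.exp (K * (|z.re| + (1 + Real.pi))) * Real.exp (Real.pi - Real.pi * z.re ^ 2) := by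
        rw [norm_div]
        gcongr
        exact (div_le_self (norm_nonneg _) hker).trans hexp
    _ = Real.exp (K * (1 + Real.pi) + Real.pi) * Real.exp (K * |z.re| - Real.pi * z.re ^ 2) := by
        rw [← Real.exp_add, ← Real.exp_add]; ring_nf
    _ ≤ _ := by
        rw [mul_assoc]; gcongr; exact exp_linear_sub_sq_le K z.re

lemma ofReal_eq_neg_omega_mul (c : ℝ) :
    (c : ℂ) = -omega * (((-(c * (√2 / 2)) : ℝ) : ℂ) + ((c * (√2 / 2) : ℝ) : ℂ) * I) := by
  have h : ((-(c * (√2 / 2)) : ℝ) : ℂ) + ((c * (√2 / 2) : ℝ) : ℂ) * I = c * omega ^ 3 := by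
    rw [omega_pow_three, omega_eq]; push_cast
    linear_combination (-(c * (√2 / 2)) : ℂ) * I_sq
  rw [h]
  linear_combination (c : ℂ) * omega_pow_four

lemma neg_omega_im_ne_zero : (-omega).im ≠ 0 := by
  rw [neg_im, omega_im, neg_ne_zero]; positivity

lemma sinKernel_half_line_ne_zero (r : ℝ) : sinKernel ((1 / 2 : ℝ) + -omega * r) ≠ 0 := by
  intro h
  obtain ⟨n, hn⟩ := (sinKernel_eq_zero_iff _).1 h
  exact line_not_int half_ne_int neg_omega_im_ne_zero r n hn

lemma half_line_mem_slitPlane (r : ℝ) : ((1 / 2 : ℝ) + -omega * r : ℂ) ∈ slitPlane := by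
  rw [mem_slitPlane_iff]
  rcases eq_or_ne r 0 with rfl | h
  · left; simp
  · right
    simp [omega_im, h]

lemma Rzeta_eq (s : ℂ) :
    Rzeta s = -omega * ∫ r : ℝ, rzetaIntegrand s ((1 / 2 : ℝ) + -omega * r) := by
  rw [Rzeta, ← integral_const_mul]
  congr 1; funext r
  rw [mul_comm, ← omega]
  congr 2
  push_cast; ring

lemma integrable_rzeta_bound {K : ℝ} (hK : 0 ≤ K) :
    Integrable fun r : ℝ => Real.exp (K * ‖log ((1 / 2 : ℝ) + -omega * r)‖) *
      ‖exp (Real.pi * I * ((1 / 2 : ℝ) + -omega * r) ^ 2) /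
        sinKernel ((1 / 2 : ℝ) + -omega * r)‖ := by
  obtain ⟨C, hC⟩ := rzeta_kernel_decay hK
  have h := integrable_line_of_eq_mul (F := fun x => ((Real.exp (K * ‖log x‖) *
      ‖exp (Real.pi * I * x ^ 2) / sinKernel x‖ : ℝ) : ℂ)) (ofReal_eq_neg_omega_mul (1 / 2)) ?_
  · exact h.re.congr (Eventually.of_forall fun r => ofReal_re _)
  have hx : ∀ r : ℝ, -omega * (r + ((1 / 2 * (√2 / 2) : ℝ) : ℂ) * I) =
      (1 / 2 : ℝ) + -omega * ((r - -(1 / 2 * (√2 / 2)) : ℝ) : ℂ) := by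
    intro r
    rw [ofReal_eq_neg_omega_mul (1 / 2)]
    push_cast; ring
  refine integrable_of_exp_decay (C := C) (R := 3) ?_ fun r hr => ?_
  · simp only [hx]
    refine continuous_ofReal.comp (Continuous.mul ?_ (Continuous.norm ?_))
    · refine Real.continuous_exp.comp (continuous_const.mul (Continuous.norm ?_))
      exact Continuous.clog (by fun_prop) fun r => half_line_mem_slitPlane _
    · exact Continuous.div (by fun_prop) (differentiable_sinKernel.continuous.comp (by fun_prop))
        fun r => sinKernel_half_line_ne_zero _
  · rw [norm_real, Real.norm_of_nonneg (by positivity)]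
    have := hC (r + ((1 / 2 * (√2 / 2) : ℝ) : ℂ) * I) ?_ (by simpa using hr)
    · simpa using this
    · have h2 := Real.sqrt_nonneg 2
      simp only [add_im, ofReal_im, mul_im, ofReal_re, I_im, I_re, mul_one, mul_zero, add_zero,
        zero_add]
      rw [abs_of_nonneg (by positivity)]
      linarith

/-- `𝓡` is entire. -/
theorem differentiable_Rzeta : Differentiable ℂ Rzeta := by
  have h1 : Rzeta = fun s => -omega * ∫ r : ℝ, rzetaIntegrand s ((1 / 2 : ℝ) + -omega * r) :=
    funext Rzeta_eq
  rw [h1]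
  refine Differentiable.const_mul (fun s => ?_) _
  have hK : (0 : ℝ) ≤ ‖s‖ + 1 := by positivity
  have hne : ∀ r : ℝ, ((1 / 2 : ℝ) + -omega * r : ℂ) ≠ 0 := fun r =>
    slitPlane_ne_zero (half_line_mem_slitPlane r)
  have := differentiableOn_integral_of_dominated (μ := (volume : Measure ℝ))
    (F := fun s (r : ℝ) => rzetaIntegrand s ((1 / 2 : ℝ) + -omega * r))
    (U := Metric.ball 0 (‖s‖ + 1)) Metric.isOpen_ball ?_ ?_ ?_ (integrable_rzeta_bound hK)
  · exact (this s (by simp)).differentiableAt (Metric.isOpen_ball.mem_nhds (by simp))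
  · intro w _
    refine Continuous.aestronglyMeasurable ?_
    simp only [rzetaIntegrand_def]
    refine Continuous.mul (Continuous.cpow (by fun_prop) continuous_const fun r =>
      half_line_mem_slitPlane r) (Continuous.div (by fun_prop)
        (differentiable_sinKernel.continuous.comp (by fun_prop)) sinKernel_half_line_ne_zero)
  · refine Eventually.of_forall fun r => Differentiable.differentiableOn ?_
    simp only [rzetaIntegrand_def]
    refine Differentiable.mul_const (Differentiable.const_cpow (by fun_prop) (Or.inl (hne r))) _
  · refine Eventually.of_forall fun r w hw => ?_
    rw [rzetaIntegrand_def, norm_mul]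
    gcongr
    exact norm_cpow_le_exp_norm_log (hne r) w (by simpa using (mem_ball_zero_iff.1 hw).le)

/-- The integrand of `𝓡(s)` on the ray of argument `π / 4`, without the power of `omega`. -/
noncomputable def rayIntegrand (s : ℂ) (r : ℝ) : ℂ :=
  (r : ℂ) ^ (-s) * (exp (-(Real.pi * r ^ 2)) / sinKernel (omega * r))

/-- The simple zero of the denominator at 0 is moved into the power. The remaining quotient is
regular at 0, and x^{−s−1} is continuous there exactly because Re s < −1. -/
lemma rzetaIntegrand_eq_dslope {s : ℂ} (hs : s.re < -1) (x : ℂ) :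
    rzetaIntegrand s x =
      x ^ (-s - 1) * (exp (Real.pi * I * x ^ 2) / dslope sinKernel 0 x) := by
  rw [rzetaIntegrand_def]
  have h1 : -s ≠ 0 := by
    intro h; have := congrArg re h; simp at this; linarith
  have h2 : -s - 1 ≠ 0 := by
    intro h; have := congrArg re h; simp at this; linarith
  rcases eq_or_ne x 0 with rfl | hx
  · rw [zero_cpow h1, zero_cpow h2, zero_mul, zero_mul]
  · rw [dslope_of_ne _ hx, slope_def_field, sinKernel_zero, sub_zero, sub_zero,
      cpow_sub _ _ hx, cpow_one]
    field_simp

lemma log_mul_omega {r : ℝ} (hr : 0 < r) :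
    log (omega * r) = Real.log r + Real.pi * I / 4 := by
  rw [mul_comm, log_ofReal_mul hr omega_ne_zero, omega, log_exp]
  · simp; linarith [Real.pi_pos]
  · simp; linarith [Real.pi_pos]

/-- The principal argument of −ω is −3π/4, whereas that of ω is π/4. The two halves of the line
through 0 therefore carry the different phases e^{3πis/4} and e^{−πis/4}. -/
lemma log_mul_neg_omega {r : ℝ} (hr : 0 < r) :
    log (-omega * r) = Real.log r - 3 * Real.pi * I / 4 := by
  have h : -omega = exp (-(3 * Real.pi * I / 4)) := by
    rw [omega, ← neg_one_mul, ← exp_neg_pi_mul_I, ← exp_add]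
    congr 1; ring
  rw [mul_comm, log_ofReal_mul hr (neg_ne_zero.2 omega_ne_zero), h, log_exp, sub_eq_add_neg]
  · simp; linarith [Real.pi_pos]
  · simp; linarith [Real.pi_pos]

lemma rzetaIntegrand_neg_omega_mul (s : ℂ) {r : ℝ} (hr : 0 < r) :
    rzetaIntegrand s (-omega * r) = -exp (3 * Real.pi * I * s / 4) * rayIntegrand s r := by
  have hr0 : (r : ℂ) ≠ 0 := ofReal_ne_zero.2 hr.ne'
  have hp : (-omega * r : ℂ) ^ (-s) = exp (3 * Real.pi * I * s / 4) * (r : ℂ) ^ (-s) := by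
    rw [cpow_def_of_ne_zero (mul_ne_zero (neg_ne_zero.2 omega_ne_zero) hr0), log_mul_neg_omega hr,
      cpow_def_of_ne_zero hr0, ← exp_add, ofReal_log hr.le]
    congr 1; ring
  have hsq : Real.pi * I * (-omega * r) ^ 2 = -(Real.pi * (r : ℂ) ^ 2) := by
    rw [mul_pow, neg_sq, omega_sq]; linear_combination (Real.pi * r ^ 2 : ℂ) * I_sq
  rw [rzetaIntegrand_def, hp, hsq, neg_mul, sinKernel_neg, rayIntegrand, div_neg]
  ring

lemma rzetaIntegrand_omega_mul (s : ℂ) {r : ℝ} (hr : 0 < r) :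
    rzetaIntegrand s (omega * r) = exp (-(Real.pi * I * s / 4)) * rayIntegrand s r := by
  have hr0 : (r : ℂ) ≠ 0 := ofReal_ne_zero.2 hr.ne'
  have hp : (omega * r : ℂ) ^ (-s) = exp (-(Real.pi * I * s / 4)) * (r : ℂ) ^ (-s) := by
    rw [cpow_def_of_ne_zero (mul_ne_zero omega_ne_zero hr0), log_mul_omega hr,
      cpow_def_of_ne_zero hr0, ← exp_add, ofReal_log hr.le]
    congr 1; ring
  have hsq : Real.pi * I * (omega * r) ^ 2 = -(Real.pi * (r : ℂ) ^ 2) := by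
    rw [mul_pow, omega_sq]; linear_combination (Real.pi * r ^ 2 : ℂ) * I_sq
  rw [rzetaIntegrand_def, hp, hsq, rayIntegrand]
  ring

/-- The line of integration of `𝓡(s)` may be moved to the origin when `s.re < -1`. -/
lemma Rzeta_eq_integral_line_zero {s : ℂ} (hs : s.re < -1) :
    (Integrable fun r : ℝ => rzetaIntegrand s (-omega * r)) ∧
      Rzeta s = -omega * ∫ r : ℝ, rzetaIntegrand s (-omega * r) := by
  have h2 := sqrt_two_div_two_bounds
  have hsq : √2 * √2 = 2 := Real.mul_self_sqrt (by norm_num)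
  have hre : ∀ z : ℂ, (-omega * z).re = √2 / 2 * (z.im - z.re) := by
    intro z; rw [mul_re, neg_re, neg_im, omega_re, omega_im]; ring
  have him : ∀ z : ℂ, (-omega * z).im = -(√2 / 2 * (z.im + z.re)) := by
    intro z; rw [mul_im, neg_re, neg_im, omega_re, omega_im]; ring
  -- A real point x = −ωz equals √2 · Im z, so the strip 0 ≤ Im z ≤ √2/4 meets the real axis only in
  -- [0, 1/2]: it avoids the cut, and the only integer in it is 0.
  have hre_of : ∀ z : ℂ, (-omega * z).im = 0 → (-omega * z).re = √2 * z.im := by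
    intro z h
    rw [him, neg_eq_zero, mul_eq_zero_iff_left (by linarith)] at h
    rw [hre, show z.re = -z.im by linarith]; ring
  have hden : ∀ z : ℂ, z.im ∈ Icc 0 (√2 / 4) → dslope sinKernel 0 (-omega * z) ≠ 0 := by
    intro z hz
    refine dslope_sinKernel_ne_zero fun n hn => ?_
    have h1 := hre_of z (by rw [hn]; simp)
    rw [hn, intCast_re] at h1
    have h3 : (n : ℝ) < 1 := by rw [h1]; nlinarith [hz.2]
    have h4 : (-1 : ℝ) < n := by rw [h1]; nlinarith [hz.1]
    have : n < 1 := by exact_mod_cast h3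
    have : -1 < n := by exact_mod_cast h4
    omega
  have hcont : ContinuousOn (fun z => rzetaIntegrand s (-omega * z))
      {z | z.im ∈ Icc 0 (√2 / 4)} := by
    simp only [rzetaIntegrand_eq_dslope hs]
    intro z hz
    refine ContinuousAt.continuousWithinAt ?_
    refine ContinuousAt.mul ?_ (ContinuousAt.div (by fun_prop) ?_ (hden z hz))
    · refine ContinuousAt.comp (g := fun x : ℂ => x ^ (-s - 1)) (f := fun z => -omega * z)
        (continuousAt_cpow_const_of_re_pos ?_ ?_) (by fun_prop)
      · by_cases h : (-omega * z).im = 0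
        · left; rw [hre_of z h]; nlinarith [hz.1]
        · exact Or.inr h
      · simp; linarith
    · exact ((differentiable_dslope_zero differentiable_sinKernel).continuous.comp
        (by fun_prop)).continuousAt
  have hdiff : DifferentiableOn ℂ (fun z => rzetaIntegrand s (-omega * z))
      {z | z.im ∈ Ioo 0 (√2 / 4)} := by
    simp only [rzetaIntegrand_eq_dslope hs]
    intro z hz
    refine DifferentiableAt.differentiableWithinAt ?_
    refine DifferentiableAt.mul ?_ (DifferentiableAt.div (by fun_prop) ?_
      (hden z ⟨hz.1.le, hz.2.le⟩))
    · refine DifferentiableAt.cpow_const (by fun_prop) ?_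
      rw [mem_slitPlane_iff]
      by_cases h : (-omega * z).im = 0
      · left; rw [hre_of z h]; nlinarith [hz.1]
      · exact Or.inr h
    · exact ((differentiable_dslope_zero differentiable_sinKernel).comp
        (by fun_prop)).differentiableAt
  obtain ⟨C, hC⟩ := rzeta_kernel_decay (norm_nonneg s)
  have hdec : ∀ z : ℂ, z.im ∈ Icc 0 (√2 / 4) → 3 ≤ |z.re| →
      ‖rzetaIntegrand s (-omega * z)‖ ≤ C * Real.exp (-|z.re|) := by
    intro z hz hz3
    have hz0 : z ≠ 0 := by rintro rfl; norm_num at hz3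
    refine le_trans ?_ (hC z (by rw [abs_of_nonneg hz.1]; exact hz.2) hz3)
    rw [rzetaIntegrand_def, norm_mul]
    gcongr
    exact norm_cpow_le_exp_norm_log (mul_ne_zero (neg_ne_zero.2 omega_ne_zero) hz0) s le_rfl
  constructor
  · refine integrable_of_exp_decay (C := C) (R := 3) ?_ fun r hr => ?_
    · exact hcont.comp_continuous continuous_ofReal fun r => by simp; positivity
    · simpa using hdec r (by simp; positivity) (by simpa using hr)
  · rw [Rzeta_eq, integral_line_eq_of_eq_mul (F := rzetaIntegrand s) (ofReal_eq_neg_omega_mul (1 / 2))]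
    have := integral_horizontal_line_eq (F := fun z => rzetaIntegrand s (-omega * z))
      (by linarith : (0 : ℝ) ≤ √2 / 4) hcont hdiff hdec
    rw [show (1 / 2 * (√2 / 2) : ℝ) = √2 / 4 by ring, ← this]
    simp

lemma integrableOn_rayIntegrand {s : ℂ} (hs : s.re < -1) :
    IntegrableOn (rayIntegrand s) (Ioi 0) := by
  have h := ((Rzeta_eq_integral_line_zero hs).1.integrableOn (s := Ioi 0)).const_mul
    (-exp (3 * Real.pi * I * s / 4))⁻¹
  refine IntegrableOn.congr_fun h (fun r hr => ?_) measurableSet_Ioi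
  rw [rzetaIntegrand_neg_omega_mul s hr, inv_mul_cancel_left₀ (neg_ne_zero.2 (exp_ne_zero _))]

lemma Rzeta_eq_ray {s : ℂ} (hs : s.re < -1) :
    Rzeta s = omega * (exp (3 * Real.pi * I * s / 4) - exp (-(Real.pi * I * s / 4))) *
      ∫ r in Ioi (0 : ℝ), rayIntegrand s r := by
  obtain ⟨hi, h⟩ := Rzeta_eq_integral_line_zero hs
  have h1 : ∫ r in Ioi (0 : ℝ), rzetaIntegrand s (-omega * r) =
      -exp (3 * Real.pi * I * s / 4) * ∫ r in Ioi (0 : ℝ), rayIntegrand s r := by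
    rw [← integral_const_mul]
    exact setIntegral_congr_fun measurableSet_Ioi fun r hr => rzetaIntegrand_neg_omega_mul s hr
  have h2 : ∫ r in Iic (0 : ℝ), rzetaIntegrand s (-omega * r) =
      exp (-(Real.pi * I * s / 4)) * ∫ r in Ioi (0 : ℝ), rayIntegrand s r := by
    have h3 := integral_comp_neg_Ioi (0 : ℝ) fun r : ℝ => rzetaIntegrand s (-omega * r)
    rw [neg_zero] at h3
    rw [← h3, ← integral_const_mul]
    refine setIntegral_congr_fun measurableSet_Ioi fun r hr => ?_
    rw [← rzetaIntegrand_omega_mul s hr]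
    push_cast; ring_nf
  rw [h, ← intervalIntegral.integral_Iic_add_Ioi hi.integrableOn hi.integrableOn, h1, h2]
  ring

/-! ### Gamma and zeta integrals with a complex rate, and the Fubini step -/

lemma norm_cpow_mul_exp_neg_mul (a r : ℂ) {t : ℝ} (ht : 0 < t) :
    ‖(t : ℂ) ^ (a - 1) * exp (-(r * t))‖ = t ^ (a.re - 1) * Real.exp (-(r.re * t)) := by
  rw [norm_mul, norm_cpow_eq_rpow_re_of_pos ht, norm_exp]
  simp

lemma integrableOn_rpow_mul_exp_neg_mul {a r : ℝ} (ha : 0 < a) (hr : 0 < r) :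
    IntegrableOn (fun t : ℝ => t ^ (a - 1) * Real.exp (-(r * t))) (Ioi 0) := by
  have := integrableOn_rpow_mul_exp_neg_mul_rpow (s := a - 1) (p := 1) (by linarith) one_pos hr
  simpa using this

lemma measurable_cpow_mul_exp_neg_mul (a r : ℂ) :
    Measurable fun t : ℝ => (t : ℂ) ^ (a - 1) * exp (-(r * t)) := by fun_prop

lemma integrableOn_cpow_mul_exp_neg_mul {a r : ℂ} (ha : 0 < a.re) (hr : 0 < r.re) :
    IntegrableOn (fun t : ℝ => (t : ℂ) ^ (a - 1) * exp (-(r * t))) (Ioi 0) := by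
  refine Integrable.mono' (integrableOn_rpow_mul_exp_neg_mul ha hr)
    (measurable_cpow_mul_exp_neg_mul a r).aestronglyMeasurable ?_
  filter_upwards [ae_restrict_mem measurableSet_Ioi] with t ht
  rw [norm_cpow_mul_exp_neg_mul a r ht]

/-- Euler's integral for the Gamma function with a complex rate. -/
theorem integral_cpow_mul_exp_neg_mul {a r : ℂ} (ha : 0 < a.re) (hr : 0 < r.re) :
    ∫ t in Ioi (0 : ℝ), (t : ℂ) ^ (a - 1) * exp (-(r * t)) = r ^ (-a) * Gamma a := by
  have hopen : ∀ δ : ℝ, IsOpen {r : ℂ | δ < r.re} := fun δ =>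
    isOpen_lt continuous_const continuous_re
  have hdiff : DifferentiableOn ℂ (fun r : ℂ => ∫ t in Ioi (0 : ℝ),
      (t : ℂ) ^ (a - 1) * exp (-(r * t))) {r | 0 < r.re} := by
    intro r₀ hr₀
    have hδ : 0 < r₀.re / 2 := half_pos hr₀
    have h := differentiableOn_integral_of_dominated (μ := volume.restrict (Ioi (0 : ℝ)))
      (F := fun r (t : ℝ) => (t : ℂ) ^ (a - 1) * exp (-(r * t))) (hopen (r₀.re / 2))
      (bound := fun t => t ^ (a.re - 1) * Real.exp (-(r₀.re / 2 * t)))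
      (fun r _ => (measurable_cpow_mul_exp_neg_mul a r).aestronglyMeasurable)
      (Eventually.of_forall fun t => by fun_prop) ?_ (integrableOn_rpow_mul_exp_neg_mul ha hδ)
    · have hmem : r₀ ∈ {r : ℂ | r₀.re / 2 < r.re} := by
        exact half_lt_self (show 0 < r₀.re from hr₀)
      exact ((h r₀ hmem).differentiableAt ((hopen _).mem_nhds hmem)).differentiableWithinAt
    · filter_upwards [ae_restrict_mem measurableSet_Ioi] with t ht r hr
      rw [norm_cpow_mul_exp_neg_mul a r ht]
      have ht' : 0 < t := ht
      have hr' : r₀.re / 2 < r.re := hr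
      gcongr
  have hdiff2 : DifferentiableOn ℂ (fun r : ℂ => r ^ (-a) * Gamma a) {r | 0 < r.re} := by
    intro r hr
    refine DifferentiableAt.differentiableWithinAt (DifferentiableAt.mul_const ?_ _)
    exact DifferentiableAt.cpow_const differentiableAt_id (Or.inl hr)
  -- Both sides are holomorphic in r on the right half plane and agree at real r near 1, so the
  -- identity theorem applies.
  refine (hdiff.analyticOnNhd (hopen 0)).eqOn_of_preconnected_of_frequently_eq
    (hdiff2.analyticOnNhd (hopen 0)) (convex_halfSpace_re_gt 0).isPreconnected
    (z₀ := 1) (by simp) ?_ hr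
  have hlim : Tendsto (fun x : ℝ => (x : ℂ)) (𝓝[≠] 1) (𝓝[≠] 1) := by
    rw [tendsto_nhdsWithin_iff]
    refine ⟨(continuous_ofReal.tendsto' 1 1 rfl).mono_left nhdsWithin_le_nhds, ?_⟩
    filter_upwards [self_mem_nhdsWithin] with x hx
    simpa using hx
  refine hlim.frequently (Eventually.frequently ?_)
  filter_upwards [nhdsWithin_le_nhds (lt_mem_nhds (zero_lt_one (α := ℝ)))] with x hx
  rw [integral_cpow_mul_exp_neg_mul_Ioi ha hx, one_div, inv_cpow, cpow_neg]
  rw [arg_ofReal_of_nonneg (le_of_lt hx)]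
  exact Real.pi_ne_zero.symm

lemma ofReal_mul_cpow {r : ℝ} (hr : 0 < r) {x : ℂ} (hx : x ≠ 0) (a : ℂ) :
    ((r : ℂ) * x) ^ a = (r : ℂ) ^ a * x ^ a := by
  have hr0 : (r : ℂ) ≠ 0 := ofReal_ne_zero.2 hr.ne'
  rw [cpow_def_of_ne_zero (mul_ne_zero hr0 hx), cpow_def_of_ne_zero hr0, cpow_def_of_ne_zero hx,
    log_ofReal_mul hr hx, ← exp_add, ofReal_log hr.le, add_mul]

/-- The Mellin transform of `1 / (1 - exp (b t))` along a ray. -/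
theorem integral_cpow_div_one_sub_exp {a b : ℂ} (ha : 1 < a.re) (hb : 0 < b.re) :
    ∫ t in Ioi (0 : ℝ), (t : ℂ) ^ (a - 1) / (1 - exp (b * t)) =
      -(Gamma a * b ^ (-a) * riemannZeta a) := by
  have ha0 : 0 < a.re := by linarith
  have hb0 : b ≠ 0 := by rintro rfl; simp at hb
  have hre : ∀ n : ℕ, (((n + 1 : ℝ) : ℂ) * b).re = (n + 1) * b.re := fun n => re_ofReal_mul _ _
  have hrepos : ∀ n : ℕ, 0 < (((n + 1 : ℝ) : ℂ) * b).re := fun n => by rw [hre]; positivity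
  have hsum := hasSum_integral_of_summable_integral_norm (μ := volume.restrict (Ioi (0 : ℝ)))
    (F := fun (n : ℕ) (t : ℝ) => (t : ℂ) ^ (a - 1) * exp (-(((n + 1 : ℝ) : ℂ) * b * t)))
    (fun n => integrableOn_cpow_mul_exp_neg_mul ha0 (hrepos n)) ?_
  · simp only [integral_cpow_mul_exp_neg_mul ha0 (hrepos _)] at hsum
    -- Since |e^{−bt}| < 1, the geometric series 1/(1 − e^{bt}) = −∑ e^{−(n+1)bt} converges.
    have h1 : ∫ t in Ioi (0 : ℝ), (t : ℂ) ^ (a - 1) / (1 - exp (b * t)) =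
        -∫ t in Ioi (0 : ℝ), ∑' n : ℕ,
          (t : ℂ) ^ (a - 1) * exp (-(((n + 1 : ℝ) : ℂ) * b * t)) := by
      rw [← integral_neg]
      refine setIntegral_congr_fun measurableSet_Ioi fun t ht => ?_
      have ht' : 0 < t := ht
      have hq : ‖exp (-(b * t))‖ < 1 := by
        rw [norm_exp, Real.exp_lt_one_iff]
        simp only [neg_re, mul_re, ofReal_re, ofReal_im, mul_zero, sub_zero]
        nlinarith
      have hq1 : (1 : ℂ) - exp (-(b * t)) ≠ 0 := by
        intro h
        rw [← sub_eq_zero.1 h] at hq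
        simp at hq
      have hterm : ∀ n : ℕ, exp (-(((n + 1 : ℝ) : ℂ) * b * t)) =
          exp (-(b * t)) * exp (-(b * t)) ^ n := by
        intro n
        rw [← exp_nat_mul, ← exp_add]; congr 1; push_cast; ring
      simp only [hterm]
      rw [tsum_mul_left, tsum_mul_left, tsum_geometric_of_norm_lt_one hq]
      have h2 : exp (b * t) = (exp (-(b * t)))⁻¹ := by rw [exp_neg, inv_inv]
      rw [h2]
      have h0 := exp_ne_zero (-(b * t))
      have h3 : (1 : ℂ) - (exp (-(b * t)))⁻¹ = -(1 - exp (-(b * t))) * (exp (-(b * t)))⁻¹ := by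
        field_simp; ring
      rw [h3]
      field_simp
    rw [h1, ← hsum.tsum_eq, zeta_eq_tsum_one_div_nat_add_one_cpow ha, ← tsum_mul_left]
    congr 1
    refine tsum_congr fun n => ?_
    rw [ofReal_mul_cpow (by positivity) hb0, cpow_neg ((n + 1 : ℝ) : ℂ)]
    push_cast
    ring
  · have hnorm : ∀ n : ℕ, ∫ t in Ioi (0 : ℝ),
        ‖(t : ℂ) ^ (a - 1) * exp (-(((n + 1 : ℝ) : ℂ) * b * t))‖ =
        1 / ((n + 1 : ℕ) : ℝ) ^ a.re * ((1 / b.re) ^ a.re * Real.Gamma a.re) := by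
      intro n
      rw [setIntegral_congr_fun measurableSet_Ioi fun t ht =>
        norm_cpow_mul_exp_neg_mul a (((n + 1 : ℝ) : ℂ) * b) ht, hre,
        Real.integral_rpow_mul_exp_neg_mul_Ioi ha0 (by positivity), ← mul_assoc,
        ← one_div_mul_one_div, Real.mul_rpow (by positivity) (by positivity),
        Real.div_rpow (by positivity) (by positivity), Real.one_rpow]
      push_cast; rfl
    simp only [hnorm]
    exact ((summable_nat_add_iff 1).2 (Real.summable_one_div_nat_rpow.2 ha)).mul_right _

/-- The rate `-2 π i omega`, which is `2 π exp (-π i / 4)`. -/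
noncomputable def rate : ℂ := ((2 * Real.pi : ℝ) : ℂ) * exp (-(Real.pi * I / 4))

lemma rate_eq : rate = -(2 * Real.pi * I * omega) := by
  have h : exp (-(Real.pi * I / 4)) = -(I * omega) := by
    rw [exp_neg, ← omega]
    refine inv_eq_of_mul_eq_one_right ?_
    linear_combination -I * omega_sq - I_sq
  rw [rate, h]; push_cast; ring

lemma rate_re : rate.re = Real.pi * √2 := by
  rw [rate_eq]; simp [omega_im]; ring

lemma rate_ne_zero : rate ≠ 0 := by
  rw [rate_eq]; simp [omega_ne_zero]

lemma log_rate : log rate = Real.log (2 * Real.pi) - Real.pi * I / 4 := by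
  rw [rate, log_ofReal_mul (by positivity) (exp_ne_zero _), log_exp, sub_eq_add_neg]
  · simp; linarith [Real.pi_pos]
  · simp; linarith [Real.pi_pos]

lemma rate_mul_line (r : ℝ) :
    rate * ((1 / 2 : ℝ) + omega ^ 3 * r) = rate / 2 + ((2 * Real.pi * r : ℝ) : ℂ) * I := by
  rw [mul_add]
  have : rate * (omega ^ 3 * r) = ((2 * Real.pi * r : ℝ) : ℂ) * I := by
    rw [rate_eq]; push_cast
    linear_combination (-(2 * Real.pi * I * r) : ℂ) * omega_pow_four
  rw [this]; push_cast; ring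

/-- Multiplication by the rate makes the Mordell line vertical. Its constant positive real part
provides one exponential in t dominating along the whole line, for both Fubini and Euler's integral.
-/
lemma rate_mul_line_re (r : ℝ) :
    (rate * ((1 / 2 : ℝ) + omega ^ 3 * r)).re = Real.pi * √2 / 2 := by
  rw [rate_mul_line]
  rw [add_re, re_ofReal_mul, I_re, mul_zero, add_zero, div_ofNat_re, rate_re]

/-- Principal powers multiply here because arg(rate · u) lies in (−π/2, π/2) and arg rate = −π/4, so
the logarithms subtract without crossing the cut. -/
lemma rate_mul_line_cpow (r : ℝ) (w : ℂ) :
    (rate * ((1 / 2 : ℝ) + omega ^ 3 * r)) ^ w =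
      rate ^ w * ((1 / 2 : ℝ) + omega ^ 3 * r) ^ w := by
  set u : ℂ := (1 / 2 : ℝ) + omega ^ 3 * r with hu
  have hre : 0 < (rate * u).re := by rw [rate_mul_line_re]; positivity
  have hne : rate * u ≠ 0 := by intro h; rw [h] at hre; simp at hre
  have hu0 : u ≠ 0 := right_ne_zero_of_mul hne
  have harg : rate.arg = -(Real.pi / 4) := by
    have := congrArg im log_rate
    rw [log_im] at this
    rw [this]; simp
  have hlog : log u = log (rate * u) - log rate := by
    have h1 : arg rate⁻¹ = Real.pi / 4 := by
      rw [arg_inv, harg, if_neg (by linarith [Real.pi_pos]), neg_neg]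
    have h2 := abs_arg_lt_pi_div_two_iff.2 (Or.inl hre)
    rw [abs_lt] at h2
    have h3 := Complex.log_mul hne (inv_ne_zero rate_ne_zero)
      ⟨by rw [h1]; linarith [Real.pi_pos], by rw [h1]; linarith [Real.pi_pos]⟩
    rw [log_inv _ (by rw [harg]; linarith [Real.pi_pos]), mul_right_comm,
      mul_inv_cancel₀ rate_ne_zero, one_mul] at h3
    rw [h3]; ring
  rw [cpow_def_of_ne_zero hne, cpow_def_of_ne_zero rate_ne_zero, cpow_def_of_ne_zero hu0, hlog,
    ← exp_add]
  congr 1; ring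

lemma mordell_omega_mul (t : ℝ) (x : ℂ) :
    mordell (omega * t) x = mordell 0 x * exp (-(rate * x * t)) := by
  rw [mordell, mordell, rate_eq, mul_zero, add_zero, exp_add]
  ring_nf

/-- Interchange of the Mordell integral with an integration along the ray of argument `π / 4`. -/
theorem integral_ray_integral_mordell {a : ℂ} (ha : 0 < a.re) :
    IntegrableOn (fun t : ℝ => (t : ℂ) ^ (a - 1) *
        ∫ r : ℝ, mordell (omega * t) ((1 / 2 : ℝ) + omega ^ 3 * r)) (Ioi 0) ∧
      ∫ t in Ioi (0 : ℝ), (t : ℂ) ^ (a - 1) *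
        ∫ r : ℝ, mordell (omega * t) ((1 / 2 : ℝ) + omega ^ 3 * r) =
      Gamma a * rate ^ (-a) * ∫ r : ℝ, mordell 0 ((1 / 2 : ℝ) + omega ^ 3 * r) *
        ((1 / 2 : ℝ) + omega ^ 3 * r) ^ (-a) := by
  set u : ℝ → ℂ := fun r => (1 / 2 : ℝ) + omega ^ 3 * r
  have hk : Integrable fun r : ℝ => mordell 0 (u r) :=
    integrable_mordell half_ne_int (by norm_num) 0
  have hpos : 0 < Real.pi * √2 / 2 := by positivity
  have hmeas : Measurable fun p : ℝ × ℝ =>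
      (p.1 : ℂ) ^ (a - 1) * (mordell 0 (u p.2) * exp (-(rate * u p.2 * p.1))) := by
    simp only [mordell, sinKernel, u]
    fun_prop
  have hint : Integrable (fun p : ℝ × ℝ =>
      (p.1 : ℂ) ^ (a - 1) * (mordell 0 (u p.2) * exp (-(rate * u p.2 * p.1))))
      ((volume.restrict (Ioi 0)).prod volume) := by
    refine Integrable.mono' ((integrableOn_rpow_mul_exp_neg_mul ha hpos).integrable.mul_prod
      hk.norm) hmeas.aestronglyMeasurable ?_
    have hae : ∀ᵐ p : ℝ × ℝ ∂((volume.restrict (Ioi (0 : ℝ))).prod volume), 0 < p.1 :=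
      Measure.quasiMeasurePreserving_fst.ae (ae_restrict_mem measurableSet_Ioi)
    filter_upwards [hae] with p hp
    have h1 := norm_cpow_mul_exp_neg_mul a (rate * u p.2) hp
    rw [rate_mul_line_re, norm_mul] at h1
    rw [norm_mul, norm_mul, ← h1]
    exact le_of_eq (by ring)
  have hEq : ∀ t : ℝ, (t : ℂ) ^ (a - 1) * ∫ r : ℝ, mordell (omega * t) (u r) =
      ∫ r : ℝ, (t : ℂ) ^ (a - 1) * (mordell 0 (u r) * exp (-(rate * u r * t))) := by
    intro t
    rw [← integral_const_mul]
    simp only [mordell_omega_mul]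
  constructor
  · change Integrable (fun t : ℝ => (t : ℂ) ^ (a - 1) * ∫ r : ℝ, mordell (omega * t) (u r))
      (volume.restrict (Ioi 0))
    simp only [hEq]
    exact hint.integral_prod_left
  · change ∫ t in Ioi (0 : ℝ), (t : ℂ) ^ (a - 1) * ∫ r : ℝ, mordell (omega * t) (u r) =
      Gamma a * rate ^ (-a) * ∫ r : ℝ, mordell 0 (u r) * u r ^ (-a)
    simp only [hEq]
    rw [integral_integral_swap hint, ← integral_const_mul]
    congr 1; funext r
    have hre : 0 < (rate * u r).re := by rw [rate_mul_line_re]; positivity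
    have h1 : ∀ t : ℝ, (t : ℂ) ^ (a - 1) * (mordell 0 (u r) * exp (-(rate * u r * t))) =
        mordell 0 (u r) * ((t : ℂ) ^ (a - 1) * exp (-(rate * u r * t))) := fun t => by ring
    simp only [h1]
    rw [integral_const_mul, integral_cpow_mul_exp_neg_mul ha hre, rate_mul_line_cpow]
    ring

/-! ### The branch of log Γ and the factor χ -/

lemma ne_neg_nat_of_mem_slitPlane {z : ℂ} (hz : z ∈ slitPlane) : ∀ m : ℕ, z ≠ -m := by
  rintro m rfl
  rw [mem_slitPlane_iff] at hz
  simp at hz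
  exact absurd hz (not_lt.2 m.cast_nonneg)

/-- Along the segment from 1 to z, which stays in the slit plane because that plane is star-shaped
about 1, Γ times exp of minus the accumulated integral of Γ'/Γ has derivative zero and starts at 1.
-/
lemma exp_logGamma {z : ℂ} (hz : z ∈ slitPlane) : exp (logGamma z) = Gamma z := by
  set γ : ℝ → ℂ := fun u => 1 + u * (z - 1)
  have hγc : Continuous γ := by fun_prop
  set V : Set ℝ := γ ⁻¹' slitPlane
  have hV : IsOpen V := isOpen_slitPlane.preimage hγc
  have hIV : ∀ u ∈ Icc (0 : ℝ) 1, u ∈ V := by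
    intro u hu
    have h := starConvex_one_slitPlane hz (sub_nonneg.2 hu.2) hu.1 (sub_add_cancel 1 u)
    simp only [real_smul] at h
    have h2 : γ u = ((1 - u : ℝ) : ℂ) * 1 + u * z := by simp only [γ]; push_cast; ring
    simpa only [V, mem_preimage, h2] using h
  have hΓd : DifferentiableOn ℂ Gamma slitPlane := fun w hw =>
    (differentiableAt_Gamma w (ne_neg_nat_of_mem_slitPlane hw)).differentiableWithinAt
  have hdig : ContinuousOn digamma slitPlane := by
    have h1 := (hΓd.deriv isOpen_slitPlane).continuousOn
    exact h1.div hΓd.continuousOn fun w hw => Gamma_ne_zero (ne_neg_nat_of_mem_slitPlane hw)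
  set f : ℝ → ℂ := fun u => digamma (γ u) * (z - 1)
  have hf : ContinuousOn f V :=
    (hdig.comp hγc.continuousOn fun u hu => hu).mul continuousOn_const
  set φ : ℝ → ℂ := fun u => ∫ v in (0 : ℝ)..u, f v
  have hφ : ∀ u ∈ Icc (0 : ℝ) 1, HasDerivAt φ (f u) u := by
    intro u hu
    refine intervalIntegral.integral_hasDerivAt_right ?_
      (hf.stronglyMeasurableAtFilter hV u (hIV u hu)) (hf.continuousAt (hV.mem_nhds (hIV u hu)))
    refine (hf.mono fun v hv => hIV v ?_).intervalIntegrable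
    rw [uIcc_of_le hu.1] at hv
    exact ⟨hv.1, hv.2.trans hu.2⟩
  have hg : ∀ u ∈ Icc (0 : ℝ) 1, HasDerivAt (fun u => Gamma (γ u) * exp (-φ u)) 0 u := by
    intro u hu
    have hm := ne_neg_nat_of_mem_slitPlane (hIV u hu)
    have h0 : HasDerivAt γ (z - 1) u := by
      have := ((hasDerivAt_id u).ofReal_comp.mul_const (z - 1)).const_add 1
      rwa [ofReal_one, one_mul] at this
    have h1 : HasDerivAt (fun u => Gamma (γ u)) (deriv Gamma (γ u) * (z - 1)) u :=
      (differentiableAt_Gamma _ hm).hasDerivAt.comp_of_eq u h0 rfl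
    refine (h1.mul (hφ u hu).neg.cexp).congr_deriv ?_
    have hne := Gamma_ne_zero hm
    have hfu : f u = deriv Gamma (γ u) / Gamma (γ u) * (z - 1) := rfl
    rw [hfu]
    field_simp
    ring
  have hconst := constant_of_has_deriv_right_zero (f := fun u => Gamma (γ u) * exp (-φ u))
    (a := 0) (b := 1) (fun u hu => (hg u hu).continuousAt.continuousWithinAt)
    (fun u hu => (hg u ⟨hu.1, hu.2.le⟩).hasDerivWithinAt) 1 (right_mem_Icc.2 zero_le_one)
  have h1 : γ 1 = z := by simp [γ]
  have h0 : γ 0 = 1 := by simp [γ]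
  have hφ0 : φ 0 = 0 := by simp [φ]
  have hφ1 : φ 1 = logGamma z := rfl
  simp only [h1, h0, hφ0, hφ1, Gamma_one, neg_zero, exp_zero, mul_one] at hconst
  rw [exp_neg, ← div_eq_mul_inv, div_eq_one_iff_eq (exp_ne_zero _)] at hconst
  exact hconst.symm

/-- For w = t − i(σ − 1/2) one has iw = s − 1/2, so the arguments of log Γ are s/2 and (1 − s)/2,
and exp(−2iϑ(w)) is `Gammaℝ (1 - s) / Gammaℝ s`. The condition Im s > 0 keeps both arguments off the
cut. -/
lemma chi_eq {s : ℂ} (hs : 0 < s.im) :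
    chi s = Gammaℂ (1 - s) * cos (Real.pi * (1 - s) / 2) := by
  have hpi : (Real.pi : ℂ) ≠ 0 := ofReal_ne_zero.2 Real.pi_ne_zero
  have hG := Gammaℝ_div_Gammaℝ_one_sub (s := 1 - s) (by
    intro n h
    have := congrArg im h
    simp at this
    linarith)
  rw [← hG, sub_sub_cancel]
  have hw : I * ((s.im : ℂ) - I * ((s.re : ℂ) - 1 / 2)) = s - 1 / 2 := by
    nth_rewrite 3 [← re_add_im s]
    linear_combination (-((s.re : ℂ) - 1 / 2)) * I_sq
  have e1 : (1 / 4 : ℂ) + I * ((s.im : ℂ) - I * ((s.re : ℂ) - 1 / 2)) / 2 = s / 2 := by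
    rw [hw]; ring
  have e2 : (1 / 4 : ℂ) - I * ((s.im : ℂ) - I * ((s.re : ℂ) - 1 / 2)) / 2 = (1 - s) / 2 := by
    rw [hw]; ring
  have m1 : s / 2 ∈ slitPlane := by
    rw [mem_slitPlane_iff]; right; simp; exact hs.ne'
  have m2 : (1 - s) / 2 ∈ slitPlane := by
    rw [mem_slitPlane_iff]; right; simp; exact hs.ne'
  rw [chi, siegelTheta, e1, e2]
  have e3 : -2 * I * ((logGamma (s / 2) - logGamma ((1 - s) / 2)) / (2 * I) -
      ((s.im : ℂ) - I * ((s.re : ℂ) - 1 / 2)) / 2 * (Real.log Real.pi : ℂ)) =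
      logGamma ((1 - s) / 2) - logGamma (s / 2) +
        (Real.log Real.pi * (-(1 - s) / 2) - Real.log Real.pi * (-s / 2)) := by
    have h1 : -2 * I * ((logGamma (s / 2) - logGamma ((1 - s) / 2)) / (2 * I)) =
        logGamma ((1 - s) / 2) - logGamma (s / 2) := by
      field_simp; ring
    rw [mul_sub, h1]
    linear_combination (Real.log Real.pi : ℂ) * hw
  rw [e3, exp_add, exp_sub, exp_sub, exp_logGamma m1, exp_logGamma m2, Gammaℝ_def, Gammaℝ_def,
    cpow_def_of_ne_zero hpi, cpow_def_of_ne_zero hpi, ofReal_log Real.pi_nonneg]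
  field_simp

/-! ### The Riemann–Siegel formula -/

lemma conj_neg_omega : (starRingEnd ℂ) (-omega) = omega ^ 3 := by
  rw [omega_pow_three, omega_eq]
  simp only [map_neg, map_mul, conj_ofReal, map_add, map_one, conj_I]
  linear_combination (-((√2 / 2 : ℝ) : ℂ)) * I_sq

lemma conj_half_line (r : ℝ) : (starRingEnd ℂ) ((1 / 2 : ℝ) + -omega * r) =
    (1 / 2 : ℝ) + omega ^ 3 * r := by
  rw [map_add, map_mul, conj_ofReal, conj_ofReal, conj_neg_omega]

lemma conj_rzetaIntegrand (s : ℂ) {x : ℂ} (hx : x ∈ slitPlane) :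
    (starRingEnd ℂ) (rzetaIntegrand (1 - (starRingEnd ℂ) s) x) =
      -(mordell 0 ((starRingEnd ℂ) x) * (starRingEnd ℂ) x ^ (-(1 - s))) := by
  have h1 : (starRingEnd ℂ) (x ^ (-(1 - (starRingEnd ℂ) s))) =
      (starRingEnd ℂ) x ^ (-(1 - s)) := by
    rw [conj_cpow _ _ (mem_slitPlane_iff_arg.1 hx).1]
    simp
  have h2 : (starRingEnd ℂ) (exp (Real.pi * I * x ^ 2)) =
      exp (-(Real.pi * I * (starRingEnd ℂ) x ^ 2)) := by
    rw [← exp_conj]; simp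
  have h3 : (starRingEnd ℂ) (sinKernel x) = -sinKernel ((starRingEnd ℂ) x) := by
    rw [sinKernel, sinKernel, map_sub, ← exp_conj, ← exp_conj]; simp
  rw [rzetaIntegrand_def, map_mul, map_div₀, h1, h2, h3, mordell, mul_zero, add_zero, div_neg]
  ring

/-- Conjugation turns the direction −ω into ω³ and flips the sign of the kernel, so the line of 𝓡
becomes the line of Mordell's integral and the Gaussian factor becomes that of y = 0. -/
lemma conj_Rzeta (s : ℂ) : (starRingEnd ℂ) (Rzeta (1 - (starRingEnd ℂ) s)) =
    -(omega ^ 3 * ∫ r : ℝ, mordell 0 ((1 / 2 : ℝ) + omega ^ 3 * r) *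
      ((1 / 2 : ℝ) + omega ^ 3 * r) ^ (-(1 - s))) := by
  rw [Rzeta_eq, map_mul, ← integral_conj, conj_neg_omega, ← mul_neg, ← integral_neg]
  congr 2; funext r
  rw [conj_rzetaIntegrand s (half_line_mem_slitPlane r), conj_half_line]

/-- The Riemann-Siegel formula in a half plane where all the integrals involved converge. -/
lemma riemannZeta_eq_of_re_lt {s : ℂ} (hs : s.re < -1) :
    riemannZeta s = Rzeta s + Gammaℂ (1 - s) * cos (Real.pi * (1 - s) / 2) *
      (starRingEnd ℂ) (Rzeta (1 - (starRingEnd ℂ) s)) := by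
  have ha : 1 < (1 - s).re := by simp; linarith
  have hpi : (Real.pi : ℂ) ≠ 0 := ofReal_ne_zero.2 Real.pi_ne_zero
  obtain ⟨hint, hval⟩ := integral_ray_integral_mordell (a := 1 - s) (by linarith)
  -- Mordell's formula at y = ωt, divided by 1 − e^{−2πiy}: here −2πiy is the rate times t, and
  -- e^{πiy²} = e^{−πt²} is the Gaussian of the ray integrand.
  have hpt : ∀ t ∈ Ioi (0 : ℝ), (t : ℂ) ^ (1 - s - 1) / (1 - exp (rate * t)) =
      omega ^ 3 * ((t : ℂ) ^ (1 - s - 1) *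
        ∫ r : ℝ, mordell (omega * t) ((1 / 2 : ℝ) + omega ^ 3 * r)) + rayIntegrand s t := by
    intro t ht
    have ht' : 0 < t := ht
    have hM := integral_mordell (omega * t)
    set G := ∫ r : ℝ, mordell (omega * t) ((1 / 2 : ℝ) + omega ^ 3 * r)
    have hr : -(2 * Real.pi * I * (omega * t)) = rate * t := by rw [rate_eq]; ring
    have hsq : Real.pi * I * (omega * t) ^ 2 = -(Real.pi * (t : ℂ) ^ 2) := by
      rw [mul_pow, omega_sq]; linear_combination (Real.pi * t ^ 2 : ℂ) * I_sq
    have hq1 : 1 - exp (rate * t) ≠ 0 := by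
      intro h
      have h1 : ‖exp (rate * t)‖ = 1 := by rw [← sub_eq_zero.1 h, norm_one]
      rw [norm_exp, Real.exp_eq_one_iff, re_mul_ofReal, rate_re] at h1
      have : 0 < Real.pi * √2 * t := by positivity
      linarith
    have hK : sinKernel (omega * t) = exp (Real.pi * I * (omega * t)) * (1 - exp (rate * t)) := by
      rw [sinKernel, ← hr, mul_sub, mul_one, ← exp_add]; congr 2; ring
    rw [hr, exp_sub, hsq] at hM
    have hE := exp_ne_zero (Real.pi * I * (omega * t))
    rw [rayIntegrand, hK, sub_sub_cancel_left]
    generalize exp (Real.pi * I * (omega * t)) = e at hM hE ⊢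
    field_simp
    field_simp at hM
    linear_combination -(t : ℂ) ^ (-s) * hM
  have hmain := integral_cpow_div_one_sub_exp ha (b := rate) (by rw [rate_re]; positivity)
  rw [setIntegral_congr_fun measurableSet_Ioi hpt, integral_add (hint.const_mul _)
    (integrableOn_rayIntegrand hs), integral_const_mul, hval] at hmain
  have hR := Rzeta_eq_ray hs
  have hconj := conj_Rzeta s
  set J := ∫ r in Ioi (0 : ℝ), rayIntegrand s r
  set A := ∫ r : ℝ, mordell 0 ((1 / 2 : ℝ) + omega ^ 3 * r) *
      ((1 / 2 : ℝ) + omega ^ 3 * r) ^ (-(1 - s))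
  have hfe := riemannZeta_one_sub (s := 1 - s) (by
    intro n h
    have := congrArg re h
    simp at this
    have h0 : (0 : ℝ) ≤ n := n.cast_nonneg
    linarith) (by
    intro h
    have := congrArg re h
    simp at this
    linarith)
  rw [sub_sub_cancel] at hfe
  have h2pi : (2 * Real.pi : ℂ) ≠ 0 := by simp [hpi]
  -- Multiplying the integrated identity by the factor linking 𝓡(s) to the ray integral must turn
  -- Γ(1 − s)·rate^{s−1} into minus the factor of the functional equation; the two exponentials
  -- combine to a cosine.
  have hcoef : Gamma (1 - s) * rate ^ (-(1 - s)) *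
      (omega * (exp (3 * Real.pi * I * s / 4) - exp (-(Real.pi * I * s / 4)))) =
      -(Gammaℂ (1 - s) * cos (Real.pi * (1 - s) / 2)) := by
    have hrate : rate ^ (-(1 - s)) = (2 * Real.pi : ℂ) ^ (-(1 - s)) *
        exp (Real.pi * I * (1 - s) / 4) := by
      rw [cpow_def_of_ne_zero rate_ne_zero, cpow_def_of_ne_zero h2pi, log_rate, ← exp_add,
        ofReal_log (by positivity)]
      congr 1; push_cast; ring
    have htrig : exp (Real.pi * I * (1 - s) / 4) *
        (omega * (exp (3 * Real.pi * I * s / 4) - exp (-(Real.pi * I * s / 4)))) =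
        -(2 * cos (Real.pi * (1 - s) / 2)) := by
      have hneg : ∀ z : ℂ, -exp z = exp (z + Real.pi * I) := fun z => by
        rw [exp_add, exp_pi_mul_I]; ring
      have p1 : exp (Real.pi * I * (1 - s) / 4) * (omega * exp (3 * Real.pi * I * s / 4)) =
          -exp (-(Real.pi * (1 - s) / 2) * I) := by
        rw [omega, ← exp_add, ← exp_add, hneg]; congr 1; ring
      have p2 : exp (Real.pi * I * (1 - s) / 4) * (omega * exp (-(Real.pi * I * s / 4))) =
          exp (Real.pi * (1 - s) / 2 * I) := by
        rw [omega, ← exp_add, ← exp_add]; congr 1; ring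
      rw [cos]
      linear_combination p1 - p2
    rw [hrate, Gammaℂ_def]
    linear_combination Gamma (1 - s) * (2 * Real.pi : ℂ) ^ (-(1 - s)) * htrig
  rw [hfe, hR, hconj]
  rw [Gammaℂ_def] at hcoef ⊢
  linear_combination
    -(omega * (exp (3 * Real.pi * I * s / 4) - exp (-(Real.pi * I * s / 4)))) * hmain +
      (omega ^ 3 * A + riemannZeta (1 - s)) * hcoef

/-- The Riemann-Siegel formula. -/
theorem riemannZeta_eq {s : ℂ} (hs : 0 < s.im) :
    riemannZeta s = Rzeta s + chi s * (starRingEnd ℂ) (Rzeta (1 - (starRingEnd ℂ) s)) := by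
  rw [chi_eq hs]
  have hopen : IsOpen {s : ℂ | 0 < s.im} := isOpen_lt continuous_const continuous_im
  have hl : DifferentiableOn ℂ riemannZeta {s : ℂ | 0 < s.im} := by
    intro z hz
    refine (differentiableAt_riemannZeta ?_).differentiableWithinAt
    rintro rfl
    simp at hz
  have hr : DifferentiableOn ℂ (fun s => Rzeta s + Gammaℂ (1 - s) * cos (Real.pi * (1 - s) / 2) *
      (starRingEnd ℂ) (Rzeta (1 - (starRingEnd ℂ) s))) {s : ℂ | 0 < s.im} := by
    intro z hz
    refine DifferentiableAt.differentiableWithinAt ?_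
    refine (differentiable_Rzeta z).add (((DifferentiableAt.mul ?_ (by fun_prop))).mul ?_)
    · have hpi : (2 * Real.pi : ℂ) ≠ 0 := by simp [Real.pi_ne_zero]
      simp only [Gammaℂ_def]
      refine DifferentiableAt.mul (DifferentiableAt.const_mul
        (DifferentiableAt.const_cpow (by fun_prop) (Or.inl hpi)) _) ?_
      refine DifferentiableAt.comp z (differentiableAt_Gamma _ ?_) (by fun_prop)
      intro m h
      have := congrArg im h
      simp at this
      exact (show 0 < z.im from hz).ne' this
    · exact differentiableAt_conj_conj_iff (f := fun w => Rzeta (1 - w)) |>.2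
        ((differentiable_Rzeta.comp (differentiable_id.const_sub 1)) _)
  -- The identity theorem on the upper half plane, starting near −2 + i, where Re s < −1.
  refine (hl.analyticOnNhd hopen).eqOn_of_preconnected_of_eventuallyEq (hr.analyticOnNhd hopen)
    (convex_halfSpace_im_gt 0).isPreconnected (z₀ := -2 + I) (by simp) ?_ hs
  have : {s : ℂ | s.re < -1} ∈ 𝓝 (-2 + I) :=
    (isOpen_lt continuous_re continuous_const).mem_nhds (by simp)
  filter_upwards [this] with z hz
  exact riemannZeta_eq_of_re_lt hz

end Analysis

/-! ### Error propagation and the choice of precisions -/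

lemma two_zpow_neg_mul_lt {D k : ℤ} {A ε : ℝ} (hε : 0 < ε) (h : k + mag A - mag ε + 1 ≤ D) :
    (2 : ℝ) ^ (-D) * A < (2 : ℝ) ^ (-k) * ε := by
  have h1 : (2 : ℝ) ^ (-D) ≤ 2 ^ (-k) * ((2 ^ mag A)⁻¹ * 2 ^ mag ε * 2⁻¹) := by
    calc (2 : ℝ) ^ (-D) ≤ 2 ^ (-k + (-mag A + mag ε + -1)) :=
          zpow_le_zpow_right₀ (by norm_num) (by omega)
      _ = _ := by
        rw [zpow_add₀ (by norm_num), zpow_add₀ (by norm_num), zpow_add₀ (by norm_num), zpow_neg_one,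
          zpow_neg _ (mag A)]
  -- The `+ 1` in the hypothesis pays for 2^(mag ε) ≤ 2ε.
  have h2 := zpow_mag_le ε hε.ne'
  rw [abs_of_pos hε] at h2
  have hp : (0 : ℝ) < 2 ^ mag A := by positivity
  have hA : A < 2 ^ mag A := (le_abs_self A).trans_lt (abs_lt_zpow_mag A)
  calc (2 : ℝ) ^ (-D) * A < 2 ^ (-D) * 2 ^ mag A := by gcongr
    _ ≤ 2 ^ (-k) * ((2 ^ mag A)⁻¹ * 2 ^ mag ε * 2⁻¹) * 2 ^ mag A := by gcongr
    _ = 2 ^ (-k) * (2 ^ mag ε / 2) := by field_simp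
    _ ≤ _ := by gcongr; linarith

/-- The radius is 2 · (1/8) + 2.032 · (1/16) = 0.377, the largest perturbation of the exponent in
`norm_expv_sub_le`. The quadratic remainder is at most (3/4)‖z‖², and 0.75 · 0.377 < 0.283. -/
lemma norm_exp_sub_one_le_of_norm_le {z : ℂ} (hz : ‖z‖ ≤ 0.377) :
    ‖Complex.exp z - 1‖ ≤ 1.283 * ‖z‖ := by
  have h := Complex.exp_bound (x := z) (by linarith) (n := 2) (by norm_num)
  norm_num [Finset.sum_range_succ, Nat.factorial] at h
  have h2 : ‖Complex.exp z - 1‖ ≤ ‖Complex.exp z - (1 + z)‖ + ‖z‖ := by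
    have := norm_add_le (Complex.exp z - (1 + z)) z
    rwa [show Complex.exp z - (1 + z) + z = Complex.exp z - 1 by ring] at this
  nlinarith [norm_nonneg z]

lemma norm_mk_rnd_sub_le (d : ℤ) (z : ℂ) :
    ‖(⟨rnd d z.re, rnd d z.im⟩ : ℂ) - z‖ ≤ (2 : ℝ) ^ (-d) * ‖z‖ := by
  have h1 := abs_rnd_sub_le d z.re
  have h2 := abs_rnd_sub_le d z.im
  set u := (2 : ℝ) ^ (-d)
  have hu : 0 < u := by positivity
  refine abs_le_of_sq_le_sq' ?_ (by positivity) |>.2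
  rw [Complex.sq_norm, Complex.normSq_apply, mul_pow, Complex.sq_norm, Complex.normSq_apply]
  simp only [Complex.sub_re, Complex.sub_im]
  have h3 : (rnd d z.re - z.re) ^ 2 ≤ (u * |z.re|) ^ 2 := by
    rw [← sq_abs]; gcongr
  have h4 : (rnd d z.im - z.im) ^ 2 ≤ (u * |z.im|) ^ 2 := by
    rw [← sq_abs]; gcongr
  rw [mul_pow, sq_abs] at h3 h4
  nlinarith

/-- The error of the computed factor `exp (-2 i ϑ)`. -/
lemma norm_expv_sub_le {d : ℤ} {θ ϑ expv : ℂ} {T X η : ℝ} (hd : 6 ≤ d)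
    (hT : ‖ϑ‖ ≤ T) (hX : ‖Complex.exp (-2 * Complex.I * ϑ)‖ ≤ X)
    (hη : η ≤ 1 / 16) (hdT : (2 : ℝ) ^ (-d) * T ≤ 1 / 8) (hu : (2 : ℝ) ^ (-d) ≤ 1 / 64)
    (hθ : ‖θ - ϑ‖ ≤ η)
    (hexpv : ‖expv - Complex.exp (cmul d (-2 * Complex.I) θ)‖ ≤
      (2 : ℝ) ^ (-d) * ‖Complex.exp (cmul d (-2 * Complex.I) θ)‖) :
    ‖expv - Complex.exp (-2 * Complex.I * ϑ)‖ ≤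
      X * (2.62 * η + 2.57 * ((2 : ℝ) ^ (-d) * T) + 1.49 * (2 : ℝ) ^ (-d)) ∧
    ‖expv‖ ≤ 1.51 * X := by
  rw [cmul_neg_two_I (by omega)] at hexpv
  set θ' : ℂ := ⟨rnd d θ.re, rnd d θ.im⟩
  have h1 : ‖θ' - θ‖ ≤ (2 : ℝ) ^ (-d) * ‖θ‖ := norm_mk_rnd_sub_le d θ
  set u := (2 : ℝ) ^ (-d)
  have hu0 : 0 < u := by positivity
  set χ := Complex.exp (-2 * Complex.I * ϑ)
  set w := Complex.exp (-2 * Complex.I * θ')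
  have hη0 : 0 ≤ η := (norm_nonneg _).trans hθ
  have hX0 : 0 ≤ X := (norm_nonneg _).trans hX
  have h2 : ‖θ‖ ≤ T + η := by
    calc ‖θ‖ = ‖ϑ + (θ - ϑ)‖ := by ring_nf
      _ ≤ _ := (norm_add_le _ _).trans (add_le_add hT hθ)
  have h3 : ‖θ' - ϑ‖ ≤ u * (T + η) + η := by
    calc ‖θ' - ϑ‖ = ‖(θ' - θ) + (θ - ϑ)‖ := by ring_nf
      _ ≤ _ := (norm_add_le _ _).trans (add_le_add (h1.trans (by gcongr)) hθ)
  have huη : u * η ≤ 1 / 64 * η := by gcongr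
  have h4 : ‖-2 * Complex.I * (θ' - ϑ)‖ ≤ 2 * (u * T) + 2.032 * η := by
    rw [norm_mul, norm_mul, norm_neg, Complex.norm_I, Complex.norm_ofNat]
    linarith
  have h5 := norm_exp_sub_one_le_of_norm_le (z := -2 * Complex.I * (θ' - ϑ)) (by linarith)
  have h6 : w = χ * Complex.exp (-2 * Complex.I * (θ' - ϑ)) := by
    simp only [w, χ]
    rw [← Complex.exp_add]; congr 1; ring
  have h7 : ‖w - χ‖ ≤ X * (1.283 * (2 * (u * T) + 2.032 * η)) := by
    rw [h6, ← mul_sub_one, norm_mul]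
    gcongr
    linarith
  have h8 : ‖w‖ ≤ X * (1 + 1.283 * (2 * (u * T) + 2.032 * η)) := by
    calc ‖w‖ = ‖χ + (w - χ)‖ := by ring_nf
      _ ≤ _ := (norm_add_le _ _).trans (by linarith)
  -- From 1 + 1.283 · 0.377 < 1.484; the relative error 1/64 of the exponential then gives 1.51.
  have h9 : ‖w‖ ≤ X * 1.484 := by
    refine h8.trans ?_
    gcongr
    linarith
  constructor
  · calc ‖expv - χ‖ = ‖(expv - w) + (w - χ)‖ := by ring_nf
      _ ≤ u * (X * 1.484) + X * (1.283 * (2 * (u * T) + 2.032 * η)) :=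
        (norm_add_le _ _).trans (add_le_add (hexpv.trans (by gcongr)) h7)
      _ = X * (1.484 * u + 2.566 * (u * T) + 1.283 * 2.032 * η) := by ring
      _ ≤ _ := by
        have : 0 ≤ u * T := mul_nonneg hu0.le ((norm_nonneg _).trans hT)
        exact mul_le_mul_of_nonneg_left (by linarith) hX0
  · calc ‖expv‖ = ‖(expv - w) + w‖ := by ring_nf
      _ ≤ 1 / 64 * (X * 1.484) + X * 1.484 :=
        (norm_add_le _ _).trans (add_le_add (hexpv.trans (by gcongr)) h9)
      _ ≤ _ := by linarith

/-- The error of `rzeta ⊕ (expv ⊗ rzeta2)`, in terms of the errors of its operands. -/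
lemma norm_zv_sub_le {d : ℤ} {a b E A B χ : ℂ} {M₁ M₂ X δ κ : ℝ} (hu : (2 : ℝ) ^ (-d) ≤ 1 / 64)
    (hA : ‖A‖ ≤ M₁) (hB : ‖B‖ ≤ M₂) (ha : ‖a - A‖ ≤ δ) (hb : ‖b - B‖ ≤ δ)
    (hE : ‖E‖ ≤ 1.51 * X) (hEχ : ‖E - χ‖ ≤ κ) (hX : 0 ≤ X) :
    ‖cadd d a (cmul d E b) - (A + χ * B)‖ ≤
      (2 : ℝ) ^ (-d) * (4.04 * M₁ + 24 * (M₂ * X)) + δ * (1.1 + 2 * X) + κ * M₂ := by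
  have h1 := norm_cmul_sub_le hu E b
  have h2 := norm_cadd_sub_le hu a (cmul d E b)
  set u := (2 : ℝ) ^ (-d)
  have hu0 : 0 < u := by positivity
  set P := cmul d E b
  have hδ : 0 ≤ δ := (norm_nonneg _).trans ha
  have hM₁ : 0 ≤ M₁ := (norm_nonneg _).trans hA
  have hM₂ : 0 ≤ M₂ := (norm_nonneg _).trans hB
  have hκ : 0 ≤ κ := (norm_nonneg _).trans hEχ
  have h3 : ‖a‖ ≤ M₁ + δ := by
    calc ‖a‖ = ‖A + (a - A)‖ := by ring_nf
      _ ≤ _ := (norm_add_le _ _).trans (add_le_add hA ha)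
  have h4 : ‖b‖ ≤ M₂ + δ := by
    calc ‖b‖ = ‖B + (b - B)‖ := by ring_nf
      _ ≤ _ := (norm_add_le _ _).trans (add_le_add hB hb)
  have h5 : ‖E‖ * ‖b‖ ≤ 1.51 * X * (M₂ + δ) := by gcongr
  have h6 : ‖P - E * b‖ ≤ 10.5 * u * (1.51 * X * (M₂ + δ)) := h1.trans (by gcongr)
  have h7 : ‖P‖ ≤ 1.76 * X * (M₂ + δ) := by
    calc ‖P‖ = ‖(P - E * b) + E * b‖ := by ring_nf
      _ ≤ 10.5 * (1 / 64) * (1.51 * X * (M₂ + δ)) + 1.51 * X * (M₂ + δ) := by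
        refine (norm_add_le _ _).trans (add_le_add (h6.trans (by gcongr)) ?_)
        rw [norm_mul]; exact h5
      _ ≤ _ := by
        have : 0 ≤ X * (M₂ + δ) := by positivity
        linarith
  have h8 : ‖E * b - χ * B‖ ≤ 1.51 * X * δ + κ * M₂ := by
    calc ‖E * b - χ * B‖ = ‖E * (b - B) + (E - χ) * B‖ := by ring_nf
      _ ≤ ‖E‖ * ‖b - B‖ + ‖E - χ‖ * ‖B‖ := by
        rw [← norm_mul, ← norm_mul]; exact norm_add_le _ _
      _ ≤ _ := by gcongr
  have h9 : ‖cadd d a P - (A + χ * B)‖ ≤ 4.04 * u * ((M₁ + δ) + 1.76 * X * (M₂ + δ)) + δ +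
      10.5 * u * (1.51 * X * (M₂ + δ)) + (1.51 * X * δ + κ * M₂) := by
    calc _ = ‖(cadd d a P - (a + P)) + (a - A) + (P - E * b) + (E * b - χ * B)‖ := by ring_nf
      _ ≤ _ := (norm_add_le _ _).trans (add_le_add ((norm_add_le _ _).trans (add_le_add
        ((norm_add_le _ _).trans (add_le_add (h2.trans (by gcongr)) ha)) h6)) h8)
  refine h9.trans ?_
  -- Mixed terms are absorbed using u ≤ 1/64. The coefficient of u·M₂·X is 4.04 · 1.76 + 10.5 · 1.51
  -- < 24, that of δ is 1 + 4.04/64 < 1.1, and that of δ·X is below 1.51 + 24/64 < 2.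
  have huδ : u * δ ≤ 1 / 64 * δ := by gcongr
  have huδX : u * (δ * X) ≤ 1 / 64 * (δ * X) := by gcongr
  have p1 : 0 ≤ u * (M₂ * X) := by positivity
  have p2 : 0 ≤ δ * X := by positivity
  nlinarith

end RiemannSiegel

open RiemannSiegel in
theorem mainTheorem2 (σ t ε M₁ M₂ X T : ℝ) (ht : 0 < t) (hε : 0 < ε)
    (hM₁ : ‖Rzeta (σ + t * Complex.I)‖ ≤ M₁)
    (hM₂ : ‖Rzeta (1 - σ + t * Complex.I)‖ ≤ M₂)
    (hX : ‖chi (σ + t * Complex.I)‖ ≤ X)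
    (hT : ‖siegelTheta (t + Complex.I * (1 / 2 - σ))‖ ≤ T)
    -- the values computed at precisions `wptheta` and `wpR`
    (theta rzeta rzeta2 : ℂ)
    (htheta : ‖theta - siegelTheta (t - Complex.I * (σ - 1 / 2))‖ ≤
      (2 : ℝ) ^ (-wptheta M₂ X ε))
    (hrzeta : ‖rzeta - Rzeta (σ + t * Complex.I)‖ ≤ (2 : ℝ) ^ (-wpR X ε))
    (hrzeta2 : ‖rzeta2 - (starRingEnd ℂ) (Rzeta (1 - σ + t * Complex.I))‖ ≤
      (2 : ℝ) ^ (-wpR X ε))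
    -- the working precision is now `d = wpbasic`; `expv` is the computed `exp(-2 * j * theta)`
    (d : ℤ) (hd : d = wpbasic M₁ M₂ X T ε)
    (expv : ℂ)
    (hexpv : ‖expv - Complex.exp (cmul d (-2 * Complex.I) theta)‖ ≤
      (2 : ℝ) ^ (-d) * ‖Complex.exp (cmul d (-2 * Complex.I) theta)‖)
    -- `zv = rzeta + exp(-2 * j * theta) * rzeta2` in floating point arithmetic
    (zv : ℂ) (hzv : zv = cadd d rzeta (cmul d expv rzeta2)) :
    IsRepresentable zv ∧ ‖zv - riemannZeta (σ + t * Complex.I)‖ < ε := by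
  refine ⟨by rw [hzv]; exact ⟨isDyadic_rnd _ _, isDyadic_rnd _ _⟩, ?_⟩
  have hd6 : 6 ≤ d := by rw [hd]; exact le_max_left _ _
  have hdT : 3 + mag T ≤ d := by
    rw [hd]; exact (le_max_left _ _).trans (le_max_right _ _)
  have hdA : 2 + mag (2.12 * M₁ + 21.2 * M₂ * X + 1.3 * M₂ * X * T) - mag ε + 1 ≤ d := by
    rw [hd]; exact (le_max_right _ _).trans (le_max_right _ _)
  have hη4 : 4 ≤ wptheta M₂ X ε := le_max_left _ _
  have hηA : 3 + mag (2.7 * M₂ * X) - mag ε + 1 ≤ wptheta M₂ X ε := le_max_right _ _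
  have hu : (2 : ℝ) ^ (-d) ≤ 1 / 64 := by
    calc (2 : ℝ) ^ (-d) ≤ 2 ^ (-6 : ℤ) := zpow_le_zpow_right₀ (by norm_num) (by omega)
      _ = 1 / 64 := by norm_num
  have hη : (2 : ℝ) ^ (-wptheta M₂ X ε) ≤ 1 / 16 := by
    calc (2 : ℝ) ^ (-wptheta M₂ X ε) ≤ 2 ^ (-4 : ℤ) := zpow_le_zpow_right₀ (by norm_num) (by omega)
      _ = 1 / 16 := by norm_num
  -- The entry 3 + mag T of `wpbasic` serves only here: it keeps the perturbation of the exponent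
  -- inside the radius 0.377.
  have huT : (2 : ℝ) ^ (-d) * T ≤ 1 / 8 := by
    calc (2 : ℝ) ^ (-d) * T ≤ 2 ^ (-3 + -mag T) * 2 ^ mag T := by
          refine mul_le_mul (zpow_le_zpow_right₀ (by norm_num) (by omega))
            ((le_abs_self T).trans_lt (abs_lt_zpow_mag T)).le ((norm_nonneg _).trans hT)
            (by positivity)
      _ = 2 ^ (-3 : ℤ) := by rw [← zpow_add₀ (by norm_num)]; congr 1; ring
      _ = 1 / 8 := by norm_num
  have b1 := two_zpow_neg_mul_lt hε hdA
  have b2 := two_zpow_neg_mul_lt hε hηA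
  have b3 := two_zpow_neg_mul_lt (D := wpR X ε) (k := 3) (A := 1.1 + 2 * X) hε le_rfl
  norm_num only [] at b1 b2 b3
  have hX0 : 0 ≤ X := (norm_nonneg _).trans hX
  have hM₁0 : 0 ≤ M₁ := (norm_nonneg _).trans hM₁
  have hM₂0 : 0 ≤ M₂ := (norm_nonneg _).trans hM₂
  have hT0 : 0 ≤ T := (norm_nonneg _).trans hT
  have hϑ : (t + Complex.I * (1 / 2 - σ) : ℂ) = t - Complex.I * (σ - 1 / 2) := by ring
  rw [hϑ] at hT
  have hchi : chi (σ + t * Complex.I) =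
      Complex.exp (-2 * Complex.I * siegelTheta (t - Complex.I * (σ - 1 / 2))) := by
    simp [chi]
  have hζ := riemannZeta_eq (s := σ + t * Complex.I) (by simpa using ht)
  have hconj : 1 - (starRingEnd ℂ) (σ + t * Complex.I : ℂ) = 1 - σ + t * Complex.I := by
    simp; ring
  rw [hconj, hchi] at hζ
  rw [hchi] at hX
  obtain ⟨e1, e2⟩ := norm_expv_sub_le hd6 hT hX hη huT hu htheta hexpv
  have hfin := norm_zv_sub_le hu hM₁ ((RCLike.norm_conj _).trans_le hM₂) hrzeta hrzeta2 e2 e1 hX0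
  rw [← hζ, ← hzv] at hfin
  refine hfin.trans_lt ?_
  set u := (2 : ℝ) ^ (-d)
  set η := (2 : ℝ) ^ (-wptheta M₂ X ε)
  set δ := (2 : ℝ) ^ (-wpR X ε)
  have hu0 : 0 < u := by positivity
  have hη0 : 0 < η := by positivity
  have p1 : 0 ≤ u * M₁ := by positivity
  have p2 : 0 ≤ u * M₂ * X := by positivity
  have p3 : 0 ≤ u * M₂ * X * T := by positivity
  have p4 : 0 ≤ η * M₂ * X := by positivity
  -- The u-part u(4.04M₁ + 25.49M₂X + 2.57M₂XT) is at most twice the quantity in `b1`, hence below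
  -- ε/2. The parts 2.62ηM₂X and δ(1.1 + 2X) are below ε/8 by `b2` and `b3`, so the total is below
  -- 3ε/4.
  nlinarith
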